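/- Let $f=\frac1n\sum_{i=1}^n f_i$ on $\mathbb{R}^d$, where each $f_i$ is convex, differentiable with $L$-Lipschitz gradient and depends only on the coordinates in a set $T_i\subseteq[d]$, where every coordinate lies in some $T_i$, and where for some $x^\star$ and $\mu>0$ the quadratic growth condition $f(x)-f(x^\star)\ge\frac\mu2\|x-x^\star\|^2$ holds for all $x$ (this holds in particular if $f$ is $\mu$-strongly convex with minimizer $x^\star$). Put $\kappa=L/\mu$, $\Delta=\frac1n\max_{v}|\{i:v\in T_i\}|$, let $D$ be the diagonal matrix with entries $D_{vv}=n/|\{i:v\in T_i\}|$, and let $D_i$ be $D$ with the diagonal entries outside $T_i$ set to $0$. Consider the asynchronous sparse accelerated SVRG method with $R$ rounds of $S$ epochs of $m$ inner iterations, started at $x_0$. Round $r$ starts with $\tilde x_0=z^0_0=x_r$. In epoch $s$, with $z_k=z^s_k$, $i_k$ uniform in $[n]$, and inner iterations ordered by the completion of their reads of the shared memory, $$\hat y_k=\vartheta\hat z_k+(1-\vartheta)\tilde x_s-\varphi D\nabla f(\tilde x_s),\quad G_k=\nabla f_{i_k}(\hat y_k)-\nabla f_{i_k}(\tilde x_s)+D_{i_k}\nabla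 f(\tilde x_s),\quad z_{k+1}=z_k-\eta G_k ,$$ where the inconsistent read is $[\hat z_k]_v=[z_0]_v-\eta\sum_j[G_j]_v$, the sum being over those $j<k$ for which coordinate $v$ was written before read $k$. Then $z^{s+1}_0=z^s_m$, $\tilde x_{s+1}=\hat y_t$ with $t$ uniform in $\{0,\dots,m-1\}$ and independent of $\hat y_0,\dots,\hat y_{m-1}$, and $x_{r+1}=\frac1S\sum_{s=0}^{S-1}\tilde x_{s+1}$. Assume that the overlaps are bounded by $\tau$ (read $k$ sees all writes of every iteration $j<k-\tau$) and that $i_k$ is independent of the snapshot $\tilde x_s$, the reads $\hat z_0,\dots,\hat z_k$ and the earlier samples $i_0,\dots,i_{k-1}$ of the epoch, jointly. Let $\omega>1$ and $c_1,c_2,c>0$ be constants, let $c_1n\le m\le c_2n$, suppose $\tau\le\frac{c}{\sqrt\Delta}\max\{\frac n\kappa,1\}$, let $\tilde\tau$ be any real number with $\tau\le\tilde\tau\le\frac{c}{\sqrt\Delta}\max\{\frac n\kappa,1\}$, and set, with $\rho=1+2\sqrt\Delta\,\tilde\tau$, $$\vartheta=\frac{\sqrt m}{\sqrt{\kappa\rho}+\sqrt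 m},\quad \varphi=\frac{1-\vartheta}{L},\quad \eta=\frac{1-\vartheta}{L\vartheta\rho},\quad S=\Big\lceil 2\omega\sqrt{\tfrac{\kappa}{m}\rho}\,\Big\rceil .$$ Then there is a constant $C$ depending only on $\omega,c_1,c_2,c$ such that $S\le C\max\{1,\sqrt{\kappa/n}\}$, and for every $x_0$ and every $\epsilon>0$ there is a number of rounds $R\le C\,\ell$, where $\ell=\max\{1,\log\frac{f(x_0)-f(x^\star)}{\epsilon}\}$ (read as $1$ if $f(x_0)=f(x^\star)$), for which every such execution outputs $x_R$ with $\mathbb{E}f(x_R)-f(x^\star)\le\epsilon$, the number of incremental gradient computations being $$\#\mathrm{grad}=R\cdot S\cdot(n+2m)\le C\max\{n,\sqrt{\kappa n}\}\,\ell .$$ -/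

import Mathlib

open MeasureTheory ProbabilityTheory

noncomputable section

namespace AsyncSVRG

/-- `ℝ^d` with the Euclidean norm. -/
abbrev Vec (d : ℕ) := EuclideanSpace ℝ (Fin d)

/-! ### The sparse finite-sum problem -/

section Problem

variable {n d : ℕ}

/-- The objective `f = (1/n) ∑ i, f_i`. -/
def obj (f : Fin n → Vec d → ℝ) (x : Vec d) : ℝ := (1 / (n : ℝ)) * ∑ i, f i x

/-- The problem class: every `f_i` is convex and `L`-smooth and depends only on the coordinates in
`T i`; every coordinate lies in some `T i`; the average `f` has `μ`-quadratic growth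
around `xstar`, which is weaker than `μ`-strong convexity of `f` and makes `xstar` its unique
minimizer. -/
structure IsProblem (f : Fin n → Vec d → ℝ) (T : Fin n → Finset (Fin d)) (L μ : ℝ)
    (xstar : Vec d) : Prop where
  n_pos : 0 < n
  L_pos : 0 < L
  mu_pos : 0 < μ
  convex : ∀ i, ConvexOn ℝ Set.univ (f i)
  differentiable : ∀ i, Differentiable ℝ (f i)
  smooth : ∀ i x y, ‖gradient (f i) x - gradient (f i) y‖ ≤ L * ‖x - y‖
  support : ∀ i x y, (∀ v ∈ T i, x v = y v) → f i x = f i y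
  covered : ∀ v, ∃ i, v ∈ T i
  growth : ∀ x, μ / 2 * ‖x - xstar‖ ^ 2 ≤ obj f x - obj f xstar

/-- The sparsity measure `Δ = (1/n) max_v |{i : v ∈ T_i}|`. -/
def sparsity (T : Fin n → Finset (Fin d)) : ℝ :=
  (1 / (n : ℝ)) *
    ((Finset.univ.sup fun v : Fin d => (Finset.univ.filter fun i : Fin n => v ∈ T i).card : ℕ) : ℝ)

/-- The `v`-th diagonal entry of `D = ((1/n) ∑ i, P_i)⁻¹`, where `P_i` is the diagonal projection
onto the coordinates in `T i`. -/
def diagD (T : Fin n → Finset (Fin d)) (v : Fin d) : ℝ :=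
  ((1 / (n : ℝ)) * ∑ i, if v ∈ T i then (1 : ℝ) else 0)⁻¹

/-- The vector `D x`. -/
def applyD (T : Fin n → Finset (Fin d)) (x : Vec d) : Vec d :=
  WithLp.toLp 2 fun v => diagD T v * x v

/-- The vector `D_i x`, where `D_i = P_i D`. -/
def applyDi (T : Fin n → Finset (Fin d)) (i : Fin n) (x : Vec d) : Vec d :=
  WithLp.toLp 2 fun v => if v ∈ T i then diagD T v * x v else 0

/-- The sparse variance-reduced gradient estimator `∇f_i(y) - ∇f_i(x̃) + D_i ∇f(x̃)`. -/
def gradEst (f : Fin n → Vec d → ℝ) (T : Fin n → Finset (Fin d)) (i : Fin n)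
    (y xt : Vec d) : Vec d :=
  gradient (f i) y - gradient (f i) xt + applyDi T i (gradient (obj f) xt)

/-- The coupling step `ϑ z + (1 - ϑ) x̃ - φ D ∇f(x̃)`. -/
def couple (f : Fin n → Vec d → ℝ) (T : Fin n → Finset (Fin d)) (ϑ φ : ℝ)
    (z xt : Vec d) : Vec d :=
  ϑ • z + (1 - ϑ) • xt - φ • applyD T (gradient (obj f) xt)

end Problem

/-! ### Parameters and oracle count

In these definitions `ρ` stands for `1 + 2 √Δ τ̃`. -/

/-- `ϑ = √m / (√(κ ρ) + √m)`. -/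
def theta (κ ρ : ℝ) (m : ℕ) : ℝ := √(m : ℝ) / (√(κ * ρ) + √(m : ℝ))

/-- `φ = (1 - ϑ) / L`. -/
def phi (L ϑ : ℝ) : ℝ := (1 - ϑ) / L

/-- `η = (1 - ϑ) / (L ϑ ρ)`. -/
def eta (L ϑ ρ : ℝ) : ℝ := (1 - ϑ) / (L * ϑ * ρ)

/-- The number of epochs per round, `S = ⌈2 ω √(κ ρ / m)⌉`. -/
def epochs (ω κ ρ : ℝ) (m : ℕ) : ℕ := ⌈2 * ω * √(κ / (m : ℝ) * ρ)⌉₊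

/-- The number of incremental gradients `∇f_i(·)` computed in `R` rounds: each epoch computes a full
gradient (`n` of them), and each of its `m` inner iterations computes two. -/
def oracleCalls (n m S R : ℕ) : ℕ :=
  ∑ _r ∈ Finset.range R, ∑ _s ∈ Finset.range S, (n + ∑ _k ∈ Finset.range m, 2)

/-! ### The asynchronous algorithm -/

/-- The random quantities of an execution. Here `r` is the round (restart), `s` the epoch and `k` the
inner iteration; inner iterations are numbered in the order in which their reads of the shared
memory are completed. -/
structure Execution (Ω : Type*) (n d m : ℕ) where
  /-- the restart point `x_r` -/
  x : ℕ → Ω → Vec d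
  /-- the snapshot `x̃_s` of round `r` -/
  snap : ℕ → ℕ → Ω → Vec d
  /-- the virtual iterate `z_k` of epoch `s` of round `r` -/
  z : ℕ → ℕ → ℕ → Ω → Vec d
  /-- the inconsistent read `ẑ_k` -/
  zhat : ℕ → ℕ → ℕ → Ω → Vec d
  /-- the sample `i_k` -/
  sample : ℕ → ℕ → ℕ → Ω → Fin n
  /-- `written r s k j`: the coordinates that were written for iteration `j` before read `k` -/
  written : ℕ → ℕ → ℕ → ℕ → Ω → Finset (Fin d)
  /-- the index `t` of the iterate that becomes the next snapshot -/
  index : ℕ → ℕ → Ω → Fin m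

section Run

variable {Ω : Type*} {n d m : ℕ}

/-- `ŷ_k = ϑ ẑ_k + (1 - ϑ) x̃_s - φ D ∇f(x̃_s)`. -/
def Execution.yhat (A : Execution Ω n d m) (f : Fin n → Vec d → ℝ) (T : Fin n → Finset (Fin d))
    (ϑ φ : ℝ) (r s k : ℕ) (w : Ω) : Vec d :=
  couple f T ϑ φ (A.zhat r s k w) (A.snap r s w)

/-- The `k`-th update direction `∇f_{i_k}(ŷ_k) - ∇f_{i_k}(x̃_s) + D_{i_k} ∇f(x̃_s)`. -/
def Execution.grad (A : Execution Ω n d m) (f : Fin n → Vec d → ℝ) (T : Fin n → Finset (Fin d))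
    (ϑ φ : ℝ) (r s k : ℕ) (w : Ω) : Vec d :=
  gradEst f T (A.sample r s k w) (A.yhat f T ϑ φ r s k w) (A.snap r s w)

/-- `A` is an execution of the asynchronous sparse accelerated SVRG method started at `x0`, with `R`
rounds of `S` epochs of `m` inner iterations, in which the overlaps are bounded by `τ` and every
sample is independent of what has been read and sampled before it. -/
structure IsRun [MeasurableSpace Ω] (P : Measure Ω) (A : Execution Ω n d m)
    (f : Fin n → Vec d → ℝ) (T : Fin n → Finset (Fin d)) (ϑ φ η : ℝ) (S R τ : ℕ)
    (x0 : Vec d) : Prop where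
  /-- the initial guess -/
  init : ∀ w, A.x 0 w = x0
  /-- `x̃_0 = z = x_r` at the start of a round -/
  snap_zero : ∀ r < R, ∀ w, A.snap r 0 w = A.x r w
  z_zero : ∀ r < R, ∀ w, A.z r 0 0 w = A.x r w
  /-- `z_{k+1} = z_k - η G_k` -/
  z_step : ∀ r < R, ∀ s < S, ∀ k < m, ∀ w,
    A.z r s (k + 1) w = A.z r s k w - η • A.grad f T ϑ φ r s k w
  /-- the shared variable is kept between epochs -/
  z_epoch : ∀ r < R, ∀ s < S, ∀ w, A.z r (s + 1) 0 w = A.z r s m w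
  /-- `[ẑ_k]_v = [z_0]_v - η ∑ [G_j]_v` over the `j < k` for which coordinate `v` was written before
  read `k` -/
  read : ∀ r < R, ∀ s < S, ∀ k < m, ∀ w v,
    A.zhat r s k w v = A.z r s 0 w v -
      η * ∑ j ∈ Finset.range k,
        if v ∈ A.written r s k j w then A.grad f T ϑ φ r s j w v else 0
  /-- bounded overlaps: read `k` sees all the writes of each iteration `j < k - τ` -/
  overlap : ∀ r < R, ∀ s < S, ∀ k < m, ∀ j, j + τ < k → ∀ w,
    T (A.sample r s j w) ⊆ A.written r s k j w
  /-- `x̃_{s+1} = ŷ_t` -/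
  snap_succ : ∀ r < R, ∀ s < S, ∀ w,
    A.snap r (s + 1) w = A.yhat f T ϑ φ r s (A.index r s w) w
  /-- `x_{r+1} = (1/S) ∑_{s<S} x̃_{s+1}` -/
  restart : ∀ r < R, ∀ w,
    A.x (r + 1) w = (1 / (S : ℝ)) • ∑ s ∈ Finset.range S, A.snap r (s + 1) w
  measurable_zhat : ∀ r < R, ∀ s < S, ∀ k < m, Measurable (A.zhat r s k)
  measurable_sample : ∀ r < R, ∀ s < S, ∀ k < m, Measurable (A.sample r s k)
  measurable_index : ∀ r < R, ∀ s < S, Measurable (A.index r s)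
  /-- `i_k` is uniform in `[n]` -/
  sample_uniform : ∀ r < R, ∀ s < S, ∀ k < m, ∀ i,
    P.real {w | A.sample r s k w = i} = 1 / (n : ℝ)
  /-- `i_k` is independent of the snapshot, of the reads `ẑ_0, …, ẑ_k` and of the samples
  `i_0, …, i_{k-1}` -/
  sample_indep : ∀ r < R, ∀ s < S, ∀ k < m,
    IndepFun (A.sample r s k)
      (fun w => (A.snap r s w, (fun j : Fin (k + 1) => A.zhat r s j w),
        (fun j : Fin k => A.sample r s j w))) P
  /-- `t` is uniform in `{0, …, m-1}` -/
  index_uniform : ∀ r < R, ∀ s < S, ∀ t, P.real {w | A.index r s w = t} = 1 / (m : ℝ)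
  /-- `t` is independent of `ŷ_0, …, ŷ_{m-1}` -/
  index_indep : ∀ r < R, ∀ s < S,
    IndepFun (A.index r s) (fun w => fun k : Fin m => A.yhat f T ϑ φ r s k w) P

end Run

end AsyncSVRG

end

/-!
The combination of `ẑ` with the snapshot in `ŷ` lets the convexity inequality of a smooth
function, `f y + ⟪∇f y, x - y⟫ + ‖∇f x - ∇f y‖² / 2L ≤ f x`, absorb the variance of the sparse
SVRG estimator, so that one inner iteration contracts the gap at the snapshot by `1 - ϑ` up to a
telescoping term `‖z - x⋆‖²`. Asynchrony adds the error `⟪G_k, ẑ_k - z_k⟫`, which involves only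
the gradient steps of overlapping iterations; these have supports meeting in few coordinates, so
by Cauchy–Schwarz the error raises the coefficient of the second moments of the steps by a factor
of at most `1 + 2 √Δ τ`, which the `ρ` in `η` pays for. Telescoping over the iterations and epochs
of a round leaves `‖x_r - x⋆‖²`, which quadratic growth bounds by the gap, and `S` is chosen such
that a round contracts the gap by `1 / ω`.
-/

namespace AsyncSVRG

/-! ### Smooth convex functions -/

section Smooth

variable {E : Type*} [NormedAddCommGroup E] [InnerProductSpace ℝ E] [CompleteSpace E]
  {g : E → ℝ} {L : ℝ}

theorem hasDerivAt_apply_add_smul (hd : Differentiable ℝ g) (x u : E) (t : ℝ) :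
    HasDerivAt (fun t : ℝ => g (x + t • u)) (inner ℝ (gradient g (x + t • u)) u) t := by
  have hline : HasDerivAt (fun t : ℝ => x + t • u) u t := by
    simpa using ((hasDerivAt_id t).smul_const u).const_add x
  rw [inner_gradient_left]
  exact (hd (x + t • u)).hasFDerivAt.comp_hasDerivAt t hline

theorem inner_gradient_le_sub (hc : ConvexOn ℝ Set.univ g) (hd : Differentiable ℝ g) (x y : E) :
    inner ℝ (gradient g x) (y - x) ≤ g y - g x := by
  have hline : ConvexOn ℝ Set.univ (fun t : ℝ => g (x + t • (y - x))) :=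
    (hc.comp_affineMap (AffineMap.lineMap x y : ℝ →ᵃ[ℝ] E)).congr fun t _ => by
      simp [AffineMap.lineMap_apply, add_comm]
  simpa [slope_def_field] using hline.le_slope_of_hasDerivAt (Set.mem_univ 0) (Set.mem_univ 1)
    one_pos (hasDerivAt_apply_add_smul hd x (y - x) 0)

theorem inner_gradient_add_smul_le (hL : ∀ x y, ‖gradient g x - gradient g y‖ ≤ L * ‖x - y‖)
    (x u : E) {t : ℝ} (ht : 0 ≤ t) :
    inner ℝ (gradient g (x + t • u)) u ≤ inner ℝ (gradient g x) u + L * t * ‖u‖ ^ 2 := by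
  rw [← sub_le_iff_le_add', ← inner_sub_left]
  calc inner ℝ (gradient g (x + t • u) - gradient g x) u
      ≤ ‖gradient g (x + t • u) - gradient g x‖ * ‖u‖ := real_inner_le_norm _ _
    _ ≤ L * ‖t • u‖ * ‖u‖ := by gcongr; simpa using hL (x + t • u) x
    _ = L * t * ‖u‖ ^ 2 := by rw [norm_smul, Real.norm_of_nonneg ht]; ring

theorem le_quadratic_of_lipschitz_gradient (hd : Differentiable ℝ g)
    (hL : ∀ x y, ‖gradient g x - gradient g y‖ ≤ L * ‖x - y‖) (x u : E) :
    g (x + u) ≤ g x + inner ℝ (gradient g x) u + L / 2 * ‖u‖ ^ 2 := by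
  have hderiv (t : ℝ) : HasDerivAt
      (fun t : ℝ => g (x + t • u) - (t * inner ℝ (gradient g x) u + L / 2 * ‖u‖ ^ 2 * t ^ 2))
      (inner ℝ (gradient g (x + t • u)) u - (inner ℝ (gradient g x) u + L * t * ‖u‖ ^ 2)) t := by
    refine (hasDerivAt_apply_add_smul hd x u t).sub (HasDerivAt.add ?_ ?_)
    · simpa using (hasDerivAt_id t).mul_const (inner ℝ (gradient g x) u)
    · refine ((hasDerivAt_pow 2 t).const_mul (L / 2 * ‖u‖ ^ 2)).congr_deriv ?_
      push_cast
      ring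
  have hanti : AntitoneOn
      (fun t : ℝ => g (x + t • u) - (t * inner ℝ (gradient g x) u + L / 2 * ‖u‖ ^ 2 * t ^ 2))
      (Set.Icc 0 1) := by
    refine antitoneOn_of_deriv_nonpos (convex_Icc 0 1)
      (fun t _ => (hderiv t).continuousAt.continuousWithinAt)
      (fun t _ => (hderiv t).differentiableAt.differentiableWithinAt) fun t ht => ?_
    rw [interior_Icc] at ht
    rw [(hderiv t).deriv, sub_nonpos]
    exact inner_gradient_add_smul_le hL x u ht.1.le
  have h01 := hanti (Set.left_mem_Icc.2 zero_le_one) (Set.right_mem_Icc.2 zero_le_one) zero_le_one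
  simp only [one_smul, zero_smul, add_zero] at h01
  linarith

theorem add_sq_norm_gradient_sub_le (hL0 : 0 < L) (hc : ConvexOn ℝ Set.univ g)
    (hd : Differentiable ℝ g) (hL : ∀ x y, ‖gradient g x - gradient g y‖ ≤ L * ‖x - y‖) (x y : E) :
    g x + inner ℝ (gradient g x) (y - x) + 1 / (2 * L) * ‖gradient g y - gradient g x‖ ^ 2 ≤
      g y := by
  -- Compare both bounds at the gradient step from `y` for `g - ⟨∇g x, ·⟩`, which `x` minimizes.
  set w := gradient g y - gradient g x with hw
  have hlower := inner_gradient_le_sub hc hd x (y + -((1 / L) • w))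
  have hupper := le_quadratic_of_lipschitz_gradient hd hL y (-((1 / L) • w))
  rw [add_sub_right_comm, inner_add_right, inner_neg_right, inner_smul_right] at hlower
  rw [inner_neg_right, inner_smul_right, norm_neg, norm_smul,
    Real.norm_of_nonneg (by positivity : (0 : ℝ) ≤ 1 / L)] at hupper
  have hcross : 1 / L * inner ℝ (gradient g y) w - 1 / L * inner ℝ (gradient g x) w =
      2 * (1 / (2 * L) * ‖w‖ ^ 2) := by
    rw [← mul_sub, ← inner_sub_left, ← hw, real_inner_self_eq_norm_sq]
    field_simp
  have hsq : L / 2 * (1 / L * ‖w‖) ^ 2 = 1 / (2 * L) * ‖w‖ ^ 2 := by field_simp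
  linarith

end Smooth

/-! ### Coordinate masks -/

section Mask

variable {ι : Type*} [DecidableEq ι]

/-- The diagonal projection `P_s` onto the coordinates in `s`. A vector `x` is supported in `s` if
`mask s x = x`. -/
noncomputable def mask (s : Finset ι) (x : EuclideanSpace ℝ ι) : EuclideanSpace ℝ ι :=
  WithLp.toLp 2 fun v => if v ∈ s then x v else 0

@[simp] theorem mask_apply (s : Finset ι) (x : EuclideanSpace ℝ ι) (v : ι) :
    mask s x v = if v ∈ s then x v else 0 := rfl

theorem mask_mask (s t : Finset ι) (x : EuclideanSpace ℝ ι) :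
    mask s (mask t x) = mask (s ∩ t) x := by
  ext v
  simp only [mask_apply, Finset.mem_inter, ite_and]

theorem mask_eq_self_of_subset {s t : Finset ι} {x : EuclideanSpace ℝ ι} (hx : mask s x = x)
    (hst : s ⊆ t) : mask t x = x := by
  rw [← hx, mask_mask, Finset.inter_eq_right.2 hst]

theorem continuous_mask (s : Finset ι) : Continuous (mask s) := by
  refine (PiLp.continuous_toLp 2 _).comp (continuous_pi fun v => ?_)
  split_ifs <;> fun_prop

variable [Fintype ι]

theorem sub_mask (s : Finset ι) (x : EuclideanSpace ℝ ι) : x - mask s x = mask sᶜ x := by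
  ext v
  by_cases hv : v ∈ s <;> simp [hv]

theorem inner_mask_left (s : Finset ι) (x y : EuclideanSpace ℝ ι) :
    inner ℝ (mask s x) y = inner ℝ x (mask s y) := by
  simp [PiLp.inner_apply]

theorem sq_norm_mask (s : Finset ι) (x : EuclideanSpace ℝ ι) :
    ‖mask s x‖ ^ 2 = ∑ v ∈ s, x v ^ 2 := by
  simp [EuclideanSpace.real_norm_sq_eq, ite_pow]

theorem norm_mask_mono {s t : Finset ι} (hst : s ⊆ t) (x : EuclideanSpace ℝ ι) :
    ‖mask s x‖ ≤ ‖mask t x‖ := by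
  refine le_of_sq_le_sq ?_ (norm_nonneg _)
  rw [sq_norm_mask, sq_norm_mask]
  exact Finset.sum_le_sum_of_subset_of_nonneg hst fun v _ _ => sq_nonneg _

theorem inner_mask_le_norm_mul_norm_mask {s : Finset ι} {x : EuclideanSpace ℝ ι}
    (hx : mask s x = x) (t : Finset ι) (y : EuclideanSpace ℝ ι) :
    inner ℝ x (mask t y) ≤ ‖x‖ * ‖mask s y‖ :=
  calc inner ℝ x (mask t y) = inner ℝ x (mask (s ∩ t) y) := by
        rw [← mask_mask, ← inner_mask_left s, hx]
    _ ≤ ‖x‖ * ‖mask (s ∩ t) y‖ := real_inner_le_norm _ _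
    _ ≤ ‖x‖ * ‖mask s y‖ := by gcongr; exact norm_mask_mono Finset.inter_subset_left y

end Mask

/-! ### The sparse gradient estimator -/

section Estimator

variable {n d : ℕ} {f : Fin n → Vec d → ℝ} {T : Fin n → Finset (Fin d)}

theorem avg_sq_norm_mask_le (T : Fin n → Finset (Fin d)) (x : Vec d) :
    (1 / (n : ℝ)) * ∑ i, ‖mask (T i) x‖ ^ 2 ≤ sparsity T * ‖x‖ ^ 2 := by
  have hcount : ∑ i, ‖mask (T i) x‖ ^ 2 =
      ∑ v, ((Finset.univ.filter fun i => v ∈ T i).card : ℝ) * x v ^ 2 := by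
    simp only [sq_norm_mask, ← nsmul_eq_mul, ← Finset.sum_const]
    exact Finset.sum_comm' (by simp)
  rw [hcount, sparsity, mul_assoc, EuclideanSpace.real_norm_sq_eq,
    Finset.mul_sum Finset.univ _ (Nat.cast _)]
  gcongr with v
  exact Finset.le_sup (f := fun v : Fin d => (Finset.univ.filter fun i : Fin n => v ∈ T i).card)
    (Finset.mem_univ v)

theorem applyDi_eq_mask (T : Fin n → Finset (Fin d)) (i : Fin n) (x : Vec d) :
    applyDi T i x = mask (T i) (applyD T x) := rfl

theorem diagD_nonneg (T : Fin n → Finset (Fin d)) (v : Fin d) : 0 ≤ diagD T v := by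
  unfold diagD
  positivity

theorem continuous_applyD (T : Fin n → Finset (Fin d)) : Continuous (applyD T) := by
  unfold applyD
  fun_prop

theorem inner_applyD_self_nonneg (T : Fin n → Finset (Fin d)) (x : Vec d) :
    0 ≤ inner ℝ x (applyD T x) := by
  rw [PiLp.inner_apply]
  refine Finset.sum_nonneg fun v _ => ?_
  calc 0 ≤ diagD T v * (x v * x v) := mul_nonneg (diagD_nonneg T v) (mul_self_nonneg _)
    _ = inner ℝ (x v) (applyD T x v) := by simp [applyD, mul_assoc]

theorem couple_phi_eq (f : Fin n → Vec d → ℝ) (T : Fin n → Finset (Fin d)) (L ϑ : ℝ)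
    (z xt : Vec d) :
    couple f T ϑ (phi L ϑ) z xt =
      ϑ • z + (1 - ϑ) • (xt - (1 / L) • applyD T (gradient (obj f) xt)) := by
  rw [couple, phi]
  module

namespace IsProblem

variable {L μ : ℝ} {xstar : Vec d}

theorem mask_gradient (h : IsProblem f T L μ xstar) (i : Fin n) (x : Vec d) :
    mask (T i) (gradient (f i) x) = gradient (f i) x := by
  ext v
  by_cases hv : v ∈ T i
  · simp [hv]
  have hconst : (fun t : ℝ => f i (x + t • EuclideanSpace.single v 1)) = fun _ => f i x := by
    refine funext fun t => h.support i _ _ fun u hu => ?_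
    simp [show u ≠ v from fun huv => hv (huv ▸ hu)]
  have hline := hasDerivAt_apply_add_smul (h.differentiable i) x (EuclideanSpace.single v 1) 0
  rw [hconst, zero_smul, add_zero, EuclideanSpace.inner_single_right] at hline
  simpa [hv] using (hline.unique (hasDerivAt_const _ _)).symm

theorem differentiable_obj (h : IsProblem f T L μ xstar) : Differentiable ℝ (obj f) :=
  (Differentiable.fun_sum fun i _ => h.differentiable i).const_mul _

theorem convexOn_obj (h : IsProblem f T L μ xstar) : ConvexOn ℝ Set.univ (obj f) := by
  refine ⟨convex_univ, fun x _ y _ a b ha hb hab => ?_⟩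
  calc obj f (a • x + b • y)
      ≤ 1 / (n : ℝ) * ∑ i, (a • f i x + b • f i y) := by
        unfold obj
        gcongr with i
        exact (h.convex i).2 (Set.mem_univ x) (Set.mem_univ y) ha hb hab
    _ = a • obj f x + b • obj f y := by
        simp only [obj, smul_eq_mul, Finset.sum_add_distrib, ← Finset.mul_sum]
        ring

theorem gradient_obj (h : IsProblem f T L μ xstar) (x : Vec d) :
    gradient (obj f) x = (1 / (n : ℝ)) • ∑ i, gradient (f i) x := by
  refine HasGradientAt.gradient (hasGradientAt_iff_hasFDerivAt.2 ?_)
  rw [map_smul, map_sum]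
  exact (HasFDerivAt.fun_sum fun i _ =>
    (h.differentiable i x).hasGradientAt.hasFDerivAt).const_mul _

theorem avg_inner_gradient (h : IsProblem f T L μ xstar) (x u : Vec d) :
    (1 / (n : ℝ)) * ∑ i, inner ℝ (gradient (f i) x) u = inner ℝ (gradient (obj f) x) u := by
  rw [h.gradient_obj, real_inner_smul_left, sum_inner]

theorem continuous_gradient (h : IsProblem f T L μ xstar) (i : Fin n) :
    Continuous (gradient (f i)) :=
  (LipschitzWith.of_dist_le_mul (K := L.toNNReal) fun x y => by
    simpa only [dist_eq_norm, Real.coe_toNNReal _ h.L_pos.le] using h.smooth i x y).continuous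

theorem continuous_gradient_obj (h : IsProblem f T L μ xstar) : Continuous (gradient (obj f)) := by
  rw [funext h.gradient_obj]
  exact (continuous_finsetSum _ fun i _ => h.continuous_gradient i).const_smul (1 / (n : ℝ))

theorem avg_applyDi (h : IsProblem f T L μ xstar) (x : Vec d) :
    (1 / (n : ℝ)) • ∑ i, applyDi T i x = x := by
  ext v
  have hfreq : 1 / (n : ℝ) * ∑ i, (if v ∈ T i then (1 : ℝ) else 0) ≠ 0 := by
    obtain ⟨i, hi⟩ := h.covered v
    have hn : (0 : ℝ) < n := Nat.cast_pos.2 h.n_pos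
    refine (mul_pos (one_div_pos.2 hn) ?_).ne'
    exact Finset.sum_pos' (fun j _ => by split_ifs <;> simp) ⟨i, Finset.mem_univ i, by simp [hi]⟩
  calc ((1 / (n : ℝ)) • ∑ i, applyDi T i x) v
      = diagD T v * (1 / (n : ℝ) * ∑ i, if v ∈ T i then (1 : ℝ) else 0) * x v := by
        simp only [applyDi, PiLp.smul_apply, WithLp.ofLp_sum, Finset.sum_apply, smul_eq_mul,
          ← mul_ite_zero, Finset.mul_sum, Finset.sum_mul]
        exact Finset.sum_congr rfl fun i _ => by split_ifs <;> ring
    _ = x v := by rw [diagD, inv_mul_cancel₀ hfreq, one_mul]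

theorem avg_inner_applyDi (h : IsProblem f T L μ xstar) (x u : Vec d) :
    (1 / (n : ℝ)) * ∑ i, inner ℝ (applyDi T i x) u = inner ℝ x u := by
  rw [← sum_inner, ← real_inner_smul_left, h.avg_applyDi]

theorem mask_gradEst (h : IsProblem f T L μ xstar) (i : Fin n) (y xt : Vec d) :
    mask (T i) (gradEst f T i y xt) = gradEst f T i y xt := by
  rw [gradEst, ← h.mask_gradient i y, ← h.mask_gradient i xt, applyDi_eq_mask]
  ext v
  by_cases hv : v ∈ T i <;> simp [hv]

theorem continuous_gradEst (h : IsProblem f T L μ xstar) (i : Fin n) :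
    Continuous fun p : Vec d × Vec d => gradEst f T i p.1 p.2 := by
  simp only [gradEst, applyDi_eq_mask]
  exact (((h.continuous_gradient i).comp continuous_fst).sub
    ((h.continuous_gradient i).comp continuous_snd)).add ((continuous_mask (T i)).comp
      ((continuous_applyD T).comp (h.continuous_gradient_obj.comp continuous_snd)))

theorem continuous_couple (h : IsProblem f T L μ xstar) (ϑ φ : ℝ) :
    Continuous fun p : Vec d × Vec d => couple f T ϑ φ p.1 p.2 := by
  unfold couple
  exact (by fun_prop : Continuous fun p : Vec d × Vec d => ϑ • p.1 + (1 - ϑ) • p.2).sub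
    (((continuous_applyD T).comp (h.continuous_gradient_obj.comp continuous_snd)).const_smul φ)

theorem avg_inner_gradEst (h : IsProblem f T L μ xstar) (y xt u : Vec d) :
    (1 / (n : ℝ)) * ∑ i, inner ℝ (gradEst f T i y xt) u = inner ℝ (gradient (obj f) y) u := by
  simp only [gradEst, inner_add_left, inner_sub_left, Finset.sum_add_distrib,
    Finset.sum_sub_distrib, mul_add, mul_sub, h.avg_inner_gradient, h.avg_inner_applyDi]
  ring

theorem sq_norm_gradEst (h : IsProblem f T L μ xstar) (i : Fin n) (y xt : Vec d) :
    ‖gradEst f T i y xt‖ ^ 2 = ‖gradient (f i) y - gradient (f i) xt‖ ^ 2 +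
      2 * (inner ℝ (gradient (f i) y) (applyD T (gradient (obj f) xt)) -
        inner ℝ (gradient (f i) xt) (applyD T (gradient (obj f) xt))) +
      inner ℝ (applyDi T i (gradient (obj f) xt)) (applyD T (gradient (obj f) xt)) := by
  rw [gradEst, norm_add_sq_real, applyDi_eq_mask, ← real_inner_self_eq_norm_sq (mask _ _),
    inner_sub_left, ← inner_mask_left, ← inner_mask_left, ← inner_mask_left, mask_mask,
    Finset.inter_self, h.mask_gradient, h.mask_gradient]

theorem avg_sq_norm_gradEst_le (h : IsProblem f T L μ xstar) (y xt : Vec d) :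
    (1 / (n : ℝ)) * ∑ i, ‖gradEst f T i y xt‖ ^ 2 ≤
      (1 / (n : ℝ)) * ∑ i, ‖gradient (f i) y - gradient (f i) xt‖ ^ 2 +
        2 * inner ℝ (gradient (obj f) y) (applyD T (gradient (obj f) xt)) := by
  have hnonneg := inner_applyD_self_nonneg T (gradient (obj f) xt)
  simp only [h.sq_norm_gradEst, Finset.sum_add_distrib, Finset.sum_sub_distrib, ← Finset.mul_sum,
    mul_add, mul_sub, mul_left_comm _ (2 : ℝ), h.avg_inner_applyDi, h.avg_inner_gradient]
  linarith

theorem obj_add_inner_add_avg_sq_norm_le (h : IsProblem f T L μ xstar) (y xt : Vec d) :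
    obj f y + inner ℝ (gradient (obj f) y) (xt - y) + 1 / (2 * L) * ((1 / (n : ℝ)) *
      ∑ i, ‖gradient (f i) y - gradient (f i) xt‖ ^ 2) ≤ obj f xt := by
  rw [← h.avg_inner_gradient, obj, obj, mul_left_comm, ← mul_add, ← mul_add, Finset.mul_sum,
    ← Finset.sum_add_distrib, ← Finset.sum_add_distrib]
  gcongr with i
  rw [norm_sub_rev]
  exact add_sq_norm_gradient_sub_le h.L_pos (h.convex i) (h.differentiable i) (h.smooth i) y xt

theorem obj_add_inner_add_avg_sq_norm_gradEst_le (h : IsProblem f T L μ xstar) (y xt : Vec d) :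
    obj f y + inner ℝ (gradient (obj f) y)
        (xt - (1 / L) • applyD T (gradient (obj f) xt) - y) +
      1 / (2 * L) * ((1 / (n : ℝ)) * ∑ i, ‖gradEst f T i y xt‖ ^ 2) ≤ obj f xt := by
  have hL := h.L_pos
  have hvar := mul_le_mul_of_nonneg_left (h.avg_sq_norm_gradEst_le y xt)
    (by positivity : 0 ≤ 1 / (2 * L))
  have hcoco := h.obj_add_inner_add_avg_sq_norm_le y xt
  rw [mul_add, ← mul_assoc (1 / (2 * L)) 2, show 1 / (2 * L) * 2 = 1 / L by field_simp] at hvar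
  rw [sub_right_comm, inner_sub_right, inner_smul_right]
  linarith

theorem obj_couple_sub_le (h : IsProblem f T L μ xstar) {ϑ : ℝ} (h0 : 0 ≤ ϑ) (h1 : ϑ ≤ 1)
    (z xt u : Vec d) {y : Vec d} (hy : y = couple f T ϑ (phi L ϑ) z xt) :
    obj f y - obj f u ≤ (1 - ϑ) * (obj f xt - obj f u) -
      (1 - ϑ) / (2 * L) * ((1 / (n : ℝ)) * ∑ i, ‖gradEst f T i y xt‖ ^ 2) +
      ϑ * inner ℝ (gradient (obj f) y) (z - u) := by
  set p := xt - (1 / L) • applyD T (gradient (obj f) xt)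
  have hu := mul_le_mul_of_nonneg_left
    (inner_gradient_le_sub h.convexOn_obj h.differentiable_obj y u) h0
  have hxt := mul_le_mul_of_nonneg_left (h.obj_add_inner_add_avg_sq_norm_gradEst_le y xt)
    (sub_nonneg.2 h1)
  have hinner : ϑ * inner ℝ (gradient (obj f) y) (u - y) +
      (1 - ϑ) * inner ℝ (gradient (obj f) y) (p - y) =
      -(ϑ * inner ℝ (gradient (obj f) y) (z - u)) := by
    have hvec : ϑ • (u - y) + (1 - ϑ) • (p - y) = -(ϑ • (z - u)) := by
      rw [hy.trans (couple_phi_eq f T L ϑ z xt)]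
      module
    simp only [← inner_smul_right, ← inner_add_right, ← inner_neg_right, hvec]
  have hcoef : (1 - ϑ) / (2 * L) = (1 - ϑ) * (1 / (2 * L)) := by ring
  rw [hcoef]
  linarith

end IsProblem

end Estimator

/-! ### Bounded measurable functions -/

section BoundedMeasurable

variable {Ω E E₁ E₂ F : Type*}

/-- `g` is `mΩ`-measurable and has bounded range. All random quantities of a run have this
property, so it replaces all integrability arguments. The σ-algebra is explicit, because it varies
between the ambient one, those generated by a part of the run, and `⊤`. -/
def BoundedMeasurable [Bornology E] [MeasurableSpace E] (mΩ : MeasurableSpace Ω) (g : Ω → E) :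
    Prop :=
  Measurable[mΩ] g ∧ Bornology.IsBounded (Set.range g)

namespace BoundedMeasurable

variable {mΩ mΩ' : MeasurableSpace Ω}

section Bornology

variable [Bornology E] [MeasurableSpace E] [Bornology F] [MeasurableSpace F] {g : Ω → E}

theorem of_measurable (hg : BoundedMeasurable mΩ g) (hm : Measurable[mΩ'] g) :
    BoundedMeasurable mΩ' g :=
  ⟨hm, hg.2⟩

theorem to_top (hg : BoundedMeasurable mΩ g) : BoundedMeasurable ⊤ g :=
  hg.of_measurable fun _ _ => trivial

theorem const (c : E) : BoundedMeasurable mΩ fun _ : Ω => c :=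
  ⟨measurable_const, Bornology.isBounded_singleton.subset Set.range_const_subset⟩

theorem prodMk {k : Ω → F} (hg : BoundedMeasurable mΩ g) (hk : BoundedMeasurable mΩ k) :
    BoundedMeasurable mΩ fun w => (g w, k w) :=
  ⟨hg.1.prodMk hk.1, (hg.2.prod hk.2).subset (Set.range_subset_iff.2 fun w => ⟨⟨w, rfl⟩, ⟨w, rfl⟩⟩)⟩

theorem isBounded_range_select {ι : Type*} [Finite ι] (X : Ω → ι) {Y : ι → Ω → E}
    (hY : ∀ i, BoundedMeasurable mΩ (Y i)) : Bornology.IsBounded (Set.range fun w => Y (X w) w) :=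
  (Bornology.isBounded_iUnion.2 fun i => (hY i).2).subset
    (Set.range_subset_iff.2 fun w => Set.mem_iUnion.2 ⟨X w, w, rfl⟩)

theorem select {ι : Type*} [Finite ι] [MeasurableSpace ι] [MeasurableSingletonClass ι]
    {X : Ω → ι} (hX : Measurable[mΩ] X) {Y : ι → Ω → E} (hY : ∀ i, BoundedMeasurable mΩ (Y i)) :
    BoundedMeasurable mΩ fun w => Y (X w) w :=
  have hmeas : Measurable fun p : ι × Ω => Y p.1 p.2 :=
    measurable_from_prod_countable_right fun i => (hY i).1
  ⟨hmeas.comp (hX.prodMk measurable_id), isBounded_range_select X hY⟩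

end Bornology

section Metric

variable [PseudoMetricSpace E] [ProperSpace E] [MeasurableSpace E] [BorelSpace E]
  [PseudoMetricSpace E₁] [ProperSpace E₁] [MeasurableSpace E₁] [BorelSpace E₁]
  [PseudoMetricSpace E₂] [ProperSpace E₂] [MeasurableSpace E₂] [BorelSpace E₂]
  [PseudoMetricSpace F] [MeasurableSpace F] [BorelSpace F]

theorem comp {g : Ω → E} (hg : BoundedMeasurable mΩ g) {q : E → F} (hq : Continuous q) :
    BoundedMeasurable mΩ fun w => q (g w) :=
  ⟨hq.measurable.comp hg.1, (hg.2.isCompact_closure.image hq).isBounded.subset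
    (Set.range_subset_iff.2 fun w => ⟨g w, subset_closure ⟨w, rfl⟩, rfl⟩)⟩

theorem comp₂ {g : Ω → E₁} {k : Ω → E₂} (hg : BoundedMeasurable mΩ g)
    (hk : BoundedMeasurable mΩ k) {q : E₁ → E₂ → F}
    (hq : Continuous fun p : E₁ × E₂ => q p.1 p.2) :
    BoundedMeasurable mΩ fun w => q (g w) (k w) :=
  (hg.prodMk hk).comp hq

end Metric

variable [NormedAddCommGroup E] [MeasurableSpace E] [BorelSpace E]

theorem integrable [SecondCountableTopology E] {P : @Measure Ω mΩ} [IsFiniteMeasure P]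
    {g : Ω → E} (hg : BoundedMeasurable mΩ g) : Integrable g P := by
  obtain ⟨C, hC⟩ := hg.2.exists_norm_le
  exact .of_bound hg.1.aestronglyMeasurable C (.of_forall fun w => hC _ ⟨w, rfl⟩)

variable [InnerProductSpace ℝ E] [FiniteDimensional ℝ E] {g k : Ω → E}

theorem const_smul (c : ℝ) (hg : BoundedMeasurable mΩ g) :
    BoundedMeasurable mΩ fun w => c • g w :=
  have := FiniteDimensional.proper ℝ E
  hg.comp (continuous_const_smul c)

theorem sub (hg : BoundedMeasurable mΩ g) (hk : BoundedMeasurable mΩ k) :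
    BoundedMeasurable mΩ fun w => g w - k w :=
  have := FiniteDimensional.proper ℝ E
  hg.comp₂ hk continuous_sub

theorem sum {ι : Type*} (s : Finset ι) {Y : ι → Ω → E}
    (hY : ∀ i ∈ s, BoundedMeasurable mΩ (Y i)) : BoundedMeasurable mΩ fun w => ∑ i ∈ s, Y i w := by
  classical
  have := FiniteDimensional.proper ℝ E
  induction s using Finset.induction_on with
  | empty => simpa only [Finset.sum_empty] using const (0 : E)
  | insert i s hi ih =>
    rw [Finset.forall_mem_insert] at hY
    simp only [Finset.sum_insert hi]
    exact hY.1.comp₂ (ih hY.2) continuous_add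

theorem inner (hg : BoundedMeasurable mΩ g) (hk : BoundedMeasurable mΩ k) :
    BoundedMeasurable mΩ fun w => Inner.inner ℝ (g w) (k w) :=
  have := FiniteDimensional.proper ℝ E
  hg.comp₂ hk continuous_inner

theorem sq_norm (hg : BoundedMeasurable mΩ g) : BoundedMeasurable mΩ fun w => ‖g w‖ ^ 2 :=
  have := FiniteDimensional.proper ℝ E
  hg.comp (continuous_norm.pow 2)

end BoundedMeasurable

theorem integral_select {ι β : Type*} [Fintype ι] [MeasurableSpace ι]
    [MeasurableSingletonClass ι] {mβ : MeasurableSpace β} [MeasurableSpace Ω] {P : Measure Ω}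
    {X : Ω → ι} {W : Ω → β} (hX : Measurable X) (hind : IndepFun X W P)
    {Y : ι → Ω → ℝ} (hY : ∀ i, Measurable[mβ.comap W] (Y i)) (hint : ∀ i, Integrable (Y i) P) :
    ∫ w, Y (X w) w ∂P = ∑ i, P.real {w | X w = i} * ∫ w, Y i w ∂P := by
  have hmeas (i : ι) : MeasurableSet {w | X w = i} := hX (measurableSet_singleton i)
  have heq (i : ι) : Set.EqOn (fun w => Y (X w) w) (Y i) {w | X w = i} := fun w (hw : X w = i) => by
    simp only [hw]
  have hcover : ⋃ i, {w | X w = i} = Set.univ := Set.iUnion_eq_univ_iff.2 fun w => ⟨X w, rfl⟩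
  have hindep (i : ι) : ∫ w in {w | X w = i}, Y i w ∂P =
      P.real {w | X w = i} * ∫ w, Y i w ∂P :=
    (indep_of_indep_of_le_right hind (hY i).comap_le).setIntegral_eq_mul (f := id) hX.comap_le
      (hint i).aemeasurable ⟨{i}, measurableSet_singleton i, rfl⟩ aestronglyMeasurable_id
  rw [← setIntegral_univ, ← hcover, integral_iUnion_fintype hmeas]
  · exact Finset.sum_congr rfl fun i _ =>
      (setIntegral_congr_fun (hmeas i) (heq i)).trans (hindep i)
  · exact fun i j hij => Set.disjoint_left.2 fun w hi hj => hij (hi.symm.trans hj)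
  · exact fun i => (hint i).integrableOn.congr_fun (heq i).symm (hmeas i)

end BoundedMeasurable

/-! ### Boundedness of a run -/

section Run

variable {Ω : Type*} {n d m : ℕ} {f : Fin n → Vec d → ℝ} {T : Fin n → Finset (Fin d)}
  {L μ : ℝ} {xstar : Vec d} {A : Execution Ω n d m} {ϑ φ η : ℝ} {r s j k : ℕ}

theorem Execution.boundedMeasurable_yhat (h : IsProblem f T L μ xstar) {mΩ : MeasurableSpace Ω}
    (hz : BoundedMeasurable mΩ (A.zhat r s k)) (hx : BoundedMeasurable mΩ (A.snap r s)) :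
    BoundedMeasurable mΩ (A.yhat f T ϑ φ r s k) :=
  hz.comp₂ hx (h.continuous_couple ϑ φ)

theorem Execution.boundedMeasurable_gradEst (h : IsProblem f T L μ xstar)
    {mΩ : MeasurableSpace Ω} (hz : BoundedMeasurable mΩ (A.zhat r s k))
    (hx : BoundedMeasurable mΩ (A.snap r s)) (i : Fin n) :
    BoundedMeasurable mΩ fun w => gradEst f T i (A.yhat f T ϑ φ r s k w) (A.snap r s w) :=
  (A.boundedMeasurable_yhat h hz hx).comp₂ hx (h.continuous_gradEst i)

theorem Execution.boundedMeasurable_grad (h : IsProblem f T L μ xstar) {mΩ : MeasurableSpace Ω}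
    (hz : BoundedMeasurable mΩ (A.zhat r s k)) (hx : BoundedMeasurable mΩ (A.snap r s))
    (hi : Measurable[mΩ] (A.sample r s k)) : BoundedMeasurable mΩ (A.grad f T ϑ φ r s k) :=
  .select hi fun i => A.boundedMeasurable_gradEst h hz hx i

theorem Execution.mask_grad (A : Execution Ω n d m) (h : IsProblem f T L μ xstar) (w : Ω) :
    mask (T (A.sample r s k w)) (A.grad f T ϑ φ r s k w) = A.grad f T ϑ φ r s k w :=
  h.mask_gradEst _ _ _

/-- What is known when the sample `i_k` is drawn: the snapshot, the reads `ẑ_0, …, ẑ_k` and the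
samples `i_0, …, i_{k-1}`. -/
def Execution.history (A : Execution Ω n d m) (r s k : ℕ) (w : Ω) :
    Vec d × (Fin (k + 1) → Vec d) × (Fin k → Fin n) :=
  (A.snap r s w, (fun j : Fin (k + 1) => A.zhat r s j w), (fun j : Fin k => A.sample r s j w))

/-- The σ-algebra generated by the history, with respect to which conditional expectations are
implicitly taken. -/
abbrev Execution.past (A : Execution Ω n d m) (r s k : ℕ) : MeasurableSpace Ω :=
  MeasurableSpace.comap (A.history r s k) inferInstance

theorem Execution.measurable_snap_past (A : Execution Ω n d m) (r s k : ℕ) :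
    Measurable[A.past r s k] (A.snap r s) :=
  measurable_fst.comp (comap_measurable (A.history r s k))

theorem Execution.measurable_zhat_past (A : Execution Ω n d m) (r s : ℕ) (hj : j ≤ k) :
    Measurable[A.past r s k] (A.zhat r s j) :=
  (((measurable_pi_apply (⟨j, Nat.lt_succ_of_le hj⟩ : Fin (k + 1))).comp measurable_fst).comp
    measurable_snd).comp (comap_measurable (A.history r s k))

theorem Execution.measurable_sample_past (A : Execution Ω n d m) (r s : ℕ) (hj : j < k) :
    Measurable[A.past r s k] (A.sample r s j) :=
  (((measurable_pi_apply (⟨j, hj⟩ : Fin k)).comp measurable_snd).comp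
    measurable_snd).comp (comap_measurable (A.history r s k))

namespace IsRun

variable [mΩ : MeasurableSpace Ω] {P : Measure Ω} {S R τ : ℕ} {x0 : Vec d}

theorem zhat_eq (hA : IsRun P A f T ϑ φ η S R τ x0) (hr : r < R) (hs : s < S) (hk : k < m) (w : Ω) :
    A.zhat r s k w = A.z r s 0 w - η • ∑ j ∈ Finset.range k,
      mask (A.written r s k j w) (A.grad f T ϑ φ r s j w) := by
  ext v
  simp [hA.read r hr s hs k hk w v]

theorem z_eq (hA : IsRun P A f T ϑ φ η S R τ x0) (hr : r < R) (hs : s < S) (hk : k ≤ m) (w : Ω) :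
    A.z r s k w = A.z r s 0 w - η • ∑ j ∈ Finset.range k, A.grad f T ϑ φ r s j w := by
  induction k with
  | zero => simp
  | succ k ih =>
    rw [hA.z_step r hr s hs k hk, ih (Nat.le_of_succ_le hk), Finset.sum_range_succ, smul_add,
      sub_sub]

section

variable (h : IsProblem f T L μ xstar) (hA : IsRun P A f T ϑ φ η S R τ x0)
include h hA

-- The written sets need not be measurable. Boundedness of the reads is therefore shown over `⊤`,
-- and their measurability is part of `IsRun`.
theorem boundedMeasurable_top_zhat (hr : r < R) (hs : s < S)
    (hx : BoundedMeasurable mΩ (A.snap r s)) (hz : BoundedMeasurable mΩ (A.z r s 0)) (hk : k < m) :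
    BoundedMeasurable ⊤ (A.zhat r s k) := by
  induction k using Nat.strong_induction_on with
  | _ k ih =>
    rw [funext (hA.zhat_eq hr hs hk)]
    refine hz.to_top.sub (.const_smul η (.sum _ fun j hj => ?_))
    have hjk := Finset.mem_range.1 hj
    have hG : BoundedMeasurable ⊤ (A.grad f T ϑ φ r s j) :=
      A.boundedMeasurable_grad h (ih j hjk (hjk.trans hk)) hx.to_top fun _ _ => trivial
    exact ⟨fun _ _ => trivial, BoundedMeasurable.isBounded_range_select (A.written r s k j)
      fun W => hG.comp (continuous_mask W)⟩

theorem boundedMeasurable_zhat_of_start (hr : r < R) (hs : s < S)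
    (hx : BoundedMeasurable mΩ (A.snap r s)) (hz : BoundedMeasurable mΩ (A.z r s 0)) (hk : k < m) :
    BoundedMeasurable mΩ (A.zhat r s k) :=
  (hA.boundedMeasurable_top_zhat h hr hs hx hz hk).of_measurable (hA.measurable_zhat r hr s hs k hk)

theorem boundedMeasurable_z_of_start (hr : r < R) (hs : s < S)
    (hx : BoundedMeasurable mΩ (A.snap r s)) (hz : BoundedMeasurable mΩ (A.z r s 0)) (hk : k ≤ m) :
    BoundedMeasurable mΩ (A.z r s k) := by
  rw [funext (hA.z_eq hr hs hk)]
  refine hz.sub (.const_smul η (.sum _ fun j hj => ?_))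
  have hj := (Finset.mem_range.1 hj).trans_le hk
  exact A.boundedMeasurable_grad h (hA.boundedMeasurable_zhat_of_start h hr hs hx hz hj) hx
    (hA.measurable_sample r hr s hs j hj)

theorem boundedMeasurable_start_of_x (hr : r < R) (hx : BoundedMeasurable mΩ (A.x r))
    (hs : s ≤ S) : BoundedMeasurable mΩ (A.snap r s) ∧ BoundedMeasurable mΩ (A.z r s 0) := by
  induction s with
  | zero =>
    rw [funext (hA.snap_zero r hr), funext (hA.z_zero r hr)]
    exact ⟨hx, hx⟩
  | succ s ih =>
    obtain ⟨hsnap, hz⟩ := ih (Nat.le_of_succ_le hs)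
    rw [funext (hA.snap_succ r hr s hs), funext (hA.z_epoch r hr s hs)]
    have hyhat (i : Fin m) : BoundedMeasurable mΩ (A.yhat f T ϑ φ r s i) :=
      A.boundedMeasurable_yhat h (hA.boundedMeasurable_zhat_of_start h hr hs hsnap hz i.2) hsnap
    exact ⟨.select (hA.measurable_index r hr s hs) hyhat,
      hA.boundedMeasurable_z_of_start h hr hs hsnap hz le_rfl⟩

theorem boundedMeasurable_x (hr : r ≤ R) : BoundedMeasurable mΩ (A.x r) := by
  induction r with
  | zero =>
    rw [funext hA.init]
    exact .const x0
  | succ r ih =>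
    rw [funext (hA.restart r hr)]
    exact .const_smul _ (.sum _ fun s hs =>
      (hA.boundedMeasurable_start_of_x h hr (ih (Nat.le_of_succ_le hr)) (Finset.mem_range.1 hs)).1)

theorem boundedMeasurable_snap (hr : r < R) (hs : s ≤ S) : BoundedMeasurable mΩ (A.snap r s) :=
  (hA.boundedMeasurable_start_of_x h hr (hA.boundedMeasurable_x h hr.le) hs).1

theorem boundedMeasurable_z_zero (hr : r < R) (hs : s ≤ S) : BoundedMeasurable mΩ (A.z r s 0) :=
  (hA.boundedMeasurable_start_of_x h hr (hA.boundedMeasurable_x h hr.le) hs).2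

theorem boundedMeasurable_z (hr : r < R) (hs : s < S) (hk : k ≤ m) :
    BoundedMeasurable mΩ (A.z r s k) :=
  hA.boundedMeasurable_z_of_start h hr hs (hA.boundedMeasurable_snap h hr hs.le)
    (hA.boundedMeasurable_z_zero h hr hs.le) hk

theorem boundedMeasurable_zhat (hr : r < R) (hs : s < S) (hk : k < m) :
    BoundedMeasurable mΩ (A.zhat r s k) :=
  hA.boundedMeasurable_zhat_of_start h hr hs (hA.boundedMeasurable_snap h hr hs.le)
    (hA.boundedMeasurable_z_zero h hr hs.le) hk

theorem boundedMeasurable_yhat (hr : r < R) (hs : s < S) (hk : k < m) :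
    BoundedMeasurable mΩ (A.yhat f T ϑ φ r s k) :=
  A.boundedMeasurable_yhat h (hA.boundedMeasurable_zhat h hr hs hk)
    (hA.boundedMeasurable_snap h hr hs.le)

theorem boundedMeasurable_grad (hr : r < R) (hs : s < S) (hk : k < m) :
    BoundedMeasurable mΩ (A.grad f T ϑ φ r s k) :=
  A.boundedMeasurable_grad h (hA.boundedMeasurable_zhat h hr hs hk)
    (hA.boundedMeasurable_snap h hr hs.le) (hA.measurable_sample r hr s hs k hk)

theorem boundedMeasurable_snap_past (hr : r < R) (hs : s < S) :
    BoundedMeasurable (A.past r s k) (A.snap r s) :=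
  (hA.boundedMeasurable_snap h hr hs.le).of_measurable (A.measurable_snap_past r s k)

theorem boundedMeasurable_zhat_past (hr : r < R) (hs : s < S) (hk : k < m) (hj : j ≤ k) :
    BoundedMeasurable (A.past r s k) (A.zhat r s j) :=
  (hA.boundedMeasurable_zhat h hr hs (hj.trans_lt hk)).of_measurable
    (A.measurable_zhat_past r s hj)

theorem boundedMeasurable_grad_past (hr : r < R) (hs : s < S) (hk : k < m) (hj : j < k) :
    BoundedMeasurable (A.past r s k) (A.grad f T ϑ φ r s j) :=
  A.boundedMeasurable_grad h (hA.boundedMeasurable_zhat_past h hr hs hk hj.le)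
    (hA.boundedMeasurable_snap_past h hr hs) (A.measurable_sample_past r s hj)

theorem boundedMeasurable_gradEst_past (hr : r < R) (hs : s < S) (hk : k < m) (i : Fin n) :
    BoundedMeasurable (A.past r s k)
      fun w => gradEst f T i (A.yhat f T ϑ φ r s k w) (A.snap r s w) :=
  A.boundedMeasurable_gradEst h (hA.boundedMeasurable_zhat_past h hr hs hk le_rfl)
    (hA.boundedMeasurable_snap_past h hr hs) i

theorem boundedMeasurable_mask_grad (hr : r < R) (hs : s < S) (hk : k < m) (hj : j < k) :
    BoundedMeasurable mΩ
      fun w => mask (T (A.sample r s k w)) (A.grad f T ϑ φ r s j w) :=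
  .select (hA.measurable_sample r hr s hs k hk) fun i =>
    (hA.boundedMeasurable_grad h hr hs (hj.trans hk)).comp (continuous_mask (T i))

end

/-! ### Expectations over the sample -/

variable [IsProbabilityMeasure P] (h : IsProblem f T L μ xstar)
  (hA : IsRun P A f T ϑ φ η S R τ x0) (hr : r < R) (hs : s < S) (hk : k < m)
include h hA hr hs hk

theorem integral_sample {Y : Fin n → Ω → ℝ} (hY : ∀ i, BoundedMeasurable (A.past r s k) (Y i)) :
    ∫ w, Y (A.sample r s k w) w ∂P = ∫ w, 1 / (n : ℝ) * ∑ i, Y i w ∂P := by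
  have hhist : Measurable (A.history r s k) :=
    (hA.boundedMeasurable_snap h hr hs.le).1.prodMk ((measurable_pi_lambda _ fun j : Fin (k + 1) =>
      hA.measurable_zhat r hr s hs j ((Nat.lt_succ_iff.1 j.2).trans_lt hk)).prodMk
      (measurable_pi_lambda _ fun j : Fin k => hA.measurable_sample r hr s hs j (j.2.trans hk)))
  have hint (i : Fin n) : Integrable (Y i) P :=
    ((hY i).of_measurable ((hY i).1.mono hhist.comap_le le_rfl)).integrable
  rw [integral_select (hA.measurable_sample r hr s hs k hk)
    (hA.sample_indep r hr s hs k hk) (fun i => (hY i).1) hint, integral_const_mul,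
    integral_finsetSum _ fun i _ => hint i, Finset.mul_sum]
  simp only [hA.sample_uniform r hr s hs k hk]

theorem integral_inner_grad {U : Ω → Vec d} (hU : BoundedMeasurable (A.past r s k) U) :
    ∫ w, inner ℝ (A.grad f T ϑ φ r s k w) (U w) ∂P =
      ∫ w, inner ℝ (gradient (obj f) (A.yhat f T ϑ φ r s k w)) (U w) ∂P :=
  (hA.integral_sample h hr hs hk fun i =>
    (hA.boundedMeasurable_gradEst_past h hr hs hk i).inner hU).trans <| by
      simp only [h.avg_inner_gradEst]

theorem integral_sq_norm_grad :
    ∫ w, ‖A.grad f T ϑ φ r s k w‖ ^ 2 ∂P =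
      ∫ w, 1 / (n : ℝ) * ∑ i, ‖gradEst f T i (A.yhat f T ϑ φ r s k w) (A.snap r s w)‖ ^ 2 ∂P :=
  hA.integral_sample h hr hs hk fun i => (hA.boundedMeasurable_gradEst_past h hr hs hk i).sq_norm

theorem integral_sq_norm_mask_grad_le (hj : j < k) :
    ∫ w, ‖mask (T (A.sample r s k w)) (A.grad f T ϑ φ r s j w)‖ ^ 2 ∂P ≤
      sparsity T * ∫ w, ‖A.grad f T ϑ φ r s j w‖ ^ 2 ∂P := by
  have hG := hA.boundedMeasurable_grad h hr hs (hj.trans hk)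
  rw [hA.integral_sample h hr hs hk fun i =>
    ((hA.boundedMeasurable_grad_past h hr hs hk hj).comp (continuous_mask (T i))).sq_norm,
    ← integral_const_mul]
  refine integral_mono ?_ (hG.sq_norm.integrable.const_mul _) fun w => avg_sq_norm_mask_le T _
  exact (BoundedMeasurable.sum _ fun i _ =>
    (hG.comp (continuous_mask (T i))).sq_norm).integrable.const_mul _

end IsRun

end Run

/-! ### Overlapping iterations -/

theorem sum_overlap_left_le (m τ : ℕ) {e : ℕ → ℝ} (he : ∀ k, 0 ≤ e k) :
    ∑ k ∈ Finset.range m, ∑ j ∈ Finset.range k with k ≤ j + τ, e k ≤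
      τ * ∑ k ∈ Finset.range m, e k := by
  rw [Finset.mul_sum]
  refine Finset.sum_le_sum fun k _ => ?_
  rw [Finset.sum_const, nsmul_eq_mul]
  refine mul_le_mul_of_nonneg_right (Nat.cast_le.2 ?_) (he k)
  refine (Finset.card_le_card (t := Finset.Ico (k - τ) k) fun j hj => ?_).trans
    (by rw [Nat.card_Ico]; omega)
  simp only [Finset.mem_filter, Finset.mem_range, Finset.mem_Ico] at hj ⊢
  omega

theorem sum_overlap_right_le (m τ : ℕ) {e : ℕ → ℝ} (he : ∀ k, 0 ≤ e k) :
    ∑ k ∈ Finset.range m, ∑ j ∈ Finset.range k with k ≤ j + τ, e j ≤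
      τ * ∑ k ∈ Finset.range m, e k := by
  rw [Finset.sum_comm' (t' := Finset.range m)
    (s' := fun j => {k ∈ Finset.range m | j < k ∧ k ≤ j + τ})
    (by simp only [Finset.mem_filter, Finset.mem_range]; omega), Finset.mul_sum]
  refine Finset.sum_le_sum fun j _ => ?_
  rw [Finset.sum_const, nsmul_eq_mul]
  refine mul_le_mul_of_nonneg_right (Nat.cast_le.2 ?_) (he j)
  refine (Finset.card_le_card (t := Finset.Ioc j (j + τ)) fun k hk => ?_).trans (by simp)
  simp only [Finset.mem_filter, Finset.mem_range, Finset.mem_Ioc] at hk ⊢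
  omega

theorem sum_overlap_le (m τ : ℕ) {e : ℕ → ℝ} (he : ∀ k, 0 ≤ e k) :
    ∑ k ∈ Finset.range m, ∑ j ∈ Finset.range k with k ≤ j + τ, (e k + e j) ≤
      2 * τ * ∑ k ∈ Finset.range m, e k := by
  simp only [Finset.sum_add_distrib]
  linarith [sum_overlap_left_le m τ he, sum_overlap_right_le m τ he]

/-! ### Expected descent -/

theorem inner_sub_eq_of_step {E : Type*} [NormedAddCommGroup E] [InnerProductSpace ℝ E] {η : ℝ}
    (hη : η ≠ 0) (G z x : E) :
    inner ℝ G (z - x) =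
      1 / (2 * η) * (‖z - x‖ ^ 2 - ‖z - η • G - x‖ ^ 2) + η / 2 * ‖G‖ ^ 2 := by
  rw [sub_right_comm, norm_sub_sq_real (z - x), norm_smul, inner_smul_right, real_inner_comm,
    mul_pow, Real.norm_eq_abs, sq_abs]
  field_simp
  ring

theorem mul_sum_succ_le_of_le_add_sub {a b : ℕ → ℝ} {ϑ c : ℝ} {S : ℕ} (hϑ : ϑ ≤ 1) (hc : 0 ≤ c)
    (hstep : ∀ s < S, a (s + 1) ≤ (1 - ϑ) * a s + c * (b s - b (s + 1))) (ha : 0 ≤ a S)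
    (hb : 0 ≤ b S) : ϑ * ∑ s ∈ Finset.range S, a (s + 1) ≤ (1 - ϑ) * a 0 + c * b 0 := by
  have hsum := Finset.sum_le_sum fun s hs => hstep s (Finset.mem_range.1 hs)
  rw [Finset.sum_add_distrib, ← Finset.mul_sum, ← Finset.mul_sum, Finset.sum_range_sub'] at hsum
  have hshift : ∑ s ∈ Finset.range S, a s = ∑ s ∈ Finset.range S, a (s + 1) + a 0 - a S := by
    rw [← Finset.sum_range_succ', Finset.sum_range_succ, add_sub_cancel_right]
  rw [hshift] at hsum
  linarith [mul_nonneg (sub_nonneg.2 hϑ) ha, mul_nonneg hc hb]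

section Descent

variable {Ω : Type*} [mΩ : MeasurableSpace Ω] {P : Measure Ω} {n d m : ℕ}
  {f : Fin n → Vec d → ℝ} {T : Fin n → Finset (Fin d)} {L μ : ℝ} {xstar : Vec d}

/-- The second moment `E ‖X‖²` of a random vector. -/
noncomputable def meanSq (P : Measure Ω) (X : Ω → Vec d) : ℝ := ∫ w, ‖X w‖ ^ 2 ∂P

/-- The expected optimality gap `E f(X) - f(x⋆)` of a random point `X`. -/
noncomputable def expectedGap (P : Measure Ω) (f : Fin n → Vec d → ℝ) (xstar : Vec d)
    (X : Ω → Vec d) : ℝ :=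
  ∫ w, obj f (X w) ∂P - obj f xstar

theorem meanSq_nonneg (X : Ω → Vec d) : 0 ≤ meanSq P X :=
  integral_nonneg fun _ => sq_nonneg _

section

variable [IsProbabilityMeasure P] {X Y : Ω → Vec d}

theorem integral_norm_mul_norm_le (hX : BoundedMeasurable mΩ X) (hY : BoundedMeasurable mΩ Y) :
    ∫ w, ‖X w‖ * ‖Y w‖ ∂P ≤ √(meanSq P X) * √(meanSq P Y) := by
  have memLp {Z : Ω → Vec d} (hZ : BoundedMeasurable mΩ Z) :
      MemLp (fun w => ‖Z w‖) (ENNReal.ofReal 2) P := by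
    rw [ENNReal.ofReal_ofNat]
    exact ((memLp_two_iff_integrable_sq_norm hZ.1.aestronglyMeasurable).2
      hZ.sq_norm.integrable).norm
  have := integral_mul_le_Lp_mul_Lq_of_nonneg Real.HolderConjugate.two_two
    (.of_forall fun w => norm_nonneg (X w)) (.of_forall fun w => norm_nonneg (Y w))
    (memLp hX) (memLp hY)
  simpa only [meanSq, Real.rpow_two, ← Real.sqrt_eq_rpow] using this

theorem IsProblem.integrable_obj (h : IsProblem f T L μ xstar) (hX : BoundedMeasurable mΩ X) :
    Integrable (fun w => obj f (X w)) P :=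
  (hX.comp h.differentiable_obj.continuous).integrable

theorem IsProblem.expectedGap_eq_integral (h : IsProblem f T L μ xstar)
    (hX : BoundedMeasurable mΩ X) :
    expectedGap P f xstar X = ∫ w, (obj f (X w) - obj f xstar) ∂P := by
  rw [integral_sub (h.integrable_obj hX) (integrable_const _), integral_const, probReal_univ,
    one_smul, expectedGap]

theorem IsProblem.meanSq_sub_le_expectedGap (h : IsProblem f T L μ xstar)
    (hX : BoundedMeasurable mΩ X) :
    μ / 2 * meanSq P (fun w => X w - xstar) ≤ expectedGap P f xstar X := by
  rw [h.expectedGap_eq_integral hX, meanSq, ← integral_const_mul]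
  exact integral_mono ((hX.sub (.const xstar)).sq_norm.integrable.const_mul _)
    ((h.integrable_obj hX).sub (integrable_const _)) fun w => h.growth (X w)

theorem IsProblem.expectedGap_nonneg (h : IsProblem f T L μ xstar)
    (hX : BoundedMeasurable mΩ X) : 0 ≤ expectedGap P f xstar X :=
  (mul_nonneg (half_pos h.mu_pos).le (meanSq_nonneg _)).trans (h.meanSq_sub_le_expectedGap hX)

theorem IsProblem.expectedGap_avg_le (h : IsProblem f T L μ xstar) {S : ℕ} (hS : 0 < S)
    {Y : ℕ → Ω → Vec d} (hY : ∀ s ∈ Finset.range S, BoundedMeasurable mΩ (Y s)) :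
    expectedGap P f xstar (fun w => (1 / (S : ℝ)) • ∑ s ∈ Finset.range S, Y s w) ≤
      1 / (S : ℝ) * ∑ s ∈ Finset.range S, expectedGap P f xstar (Y s) := by
  have hS0 : (S : ℝ) ≠ 0 := Nat.cast_ne_zero.2 hS.ne'
  have jensen (w : Ω) : obj f ((1 / (S : ℝ)) • ∑ s ∈ Finset.range S, Y s w) ≤
      1 / (S : ℝ) * ∑ s ∈ Finset.range S, obj f (Y s w) := by
    rw [Finset.smul_sum, Finset.mul_sum]
    exact h.convexOn_obj.map_sum_le (fun _ _ => by positivity) (by simp [hS0])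
      fun _ _ => Set.mem_univ _
  have hle := integral_mono (μ := P) (h.integrable_obj (.const_smul _ (.sum _ hY)))
    ((integrable_finsetSum _ fun s hs => h.integrable_obj (hY s hs)).const_mul _) jensen
  rw [integral_const_mul, integral_finsetSum _ fun s hs => h.integrable_obj (hY s hs)] at hle
  have hsum : 1 / (S : ℝ) * ∑ s ∈ Finset.range S, expectedGap P f xstar (Y s) =
      1 / (S : ℝ) * ∑ s ∈ Finset.range S, ∫ w, obj f (Y s w) ∂P - obj f xstar := by
    simp only [expectedGap, Finset.sum_sub_distrib, Finset.sum_const, Finset.card_range,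
      nsmul_eq_mul]
    field_simp
  rw [hsum, expectedGap]
  exact sub_le_sub_right hle _

end

namespace IsRun

variable {A : Execution Ω n d m} {ϑ φ η : ℝ} {r s j k S R τ : ℕ} {x0 : Vec d}

theorem zhat_sub_z_eq (h : IsProblem f T L μ xstar) (hA : IsRun P A f T ϑ φ η S R τ x0)
    (hr : r < R) (hs : s < S) (hk : k < m) (w : Ω) :
    A.zhat r s k w - A.z r s k w = η • ∑ j ∈ Finset.range k with k ≤ j + τ,
      mask (A.written r s k j w)ᶜ (A.grad f T ϑ φ r s j w) := by
  rw [hA.zhat_eq hr hs hk, hA.z_eq hr hs hk.le, sub_sub_sub_cancel_left, ← smul_sub,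
    ← Finset.sum_sub_distrib]
  simp only [sub_mask]
  refine congrArg (η • ·) (Finset.sum_filter_of_ne fun j _ hne => ?_).symm
  contrapose! hne
  rw [← sub_mask, mask_eq_self_of_subset (A.mask_grad h w) (hA.overlap r hr s hs k hk j hne w),
    sub_self]

theorem inner_grad_zhat_sub_z_le (h : IsProblem f T L μ xstar)
    (hA : IsRun P A f T ϑ φ η S R τ x0) (hr : r < R) (hs : s < S) (hk : k < m) (hη : 0 ≤ η)
    (w : Ω) :
    inner ℝ (A.grad f T ϑ φ r s k w) (A.zhat r s k w - A.z r s k w) ≤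
      η * ∑ j ∈ Finset.range k with k ≤ j + τ,
        ‖A.grad f T ϑ φ r s k w‖ * ‖mask (T (A.sample r s k w)) (A.grad f T ϑ φ r s j w)‖ := by
  rw [hA.zhat_sub_z_eq h hr hs hk, inner_smul_right, inner_sum]
  exact mul_le_mul_of_nonneg_left (Finset.sum_le_sum fun j _ =>
    inner_mask_le_norm_mul_norm_mask (A.mask_grad h w) _ _) hη

variable [IsProbabilityMeasure P]

section

variable (h : IsProblem f T L μ xstar) (hA : IsRun P A f T ϑ φ η S R τ x0)
  (hr : r < R) (hs : s < S)
include h hA hr hs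

theorem integral_norm_grad_mul_norm_mask_le (hk : k < m) (hj : j < k) :
    ∫ w, ‖A.grad f T ϑ φ r s k w‖ * ‖mask (T (A.sample r s k w)) (A.grad f T ϑ φ r s j w)‖ ∂P ≤
      √(sparsity T) / 2 *
        (meanSq P (A.grad f T ϑ φ r s k) + meanSq P (A.grad f T ϑ φ r s j)) := by
  set a := meanSq P (A.grad f T ϑ φ r s k)
  set b := meanSq P (A.grad f T ϑ φ r s j)
  have ha0 : 0 ≤ a := meanSq_nonneg _
  have hb0 : 0 ≤ b := meanSq_nonneg _
  have am_gm : √a * √b ≤ (a + b) / 2 := by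
    nlinarith [sq_nonneg (√a - √b), Real.sq_sqrt ha0, Real.sq_sqrt hb0]
  calc _ ≤ √a * √(∫ w, ‖mask (T (A.sample r s k w)) (A.grad f T ϑ φ r s j w)‖ ^ 2 ∂P) :=
        integral_norm_mul_norm_le (hA.boundedMeasurable_grad h hr hs hk)
          (hA.boundedMeasurable_mask_grad h hr hs hk hj)
    _ ≤ √a * √(sparsity T * b) := by
        gcongr
        exact hA.integral_sq_norm_mask_grad_le h hr hs hk hj
    _ = √(sparsity T) * (√a * √b) := by rw [Real.sqrt_mul' _ hb0]; ring
    _ ≤ √(sparsity T) * ((a + b) / 2) := by gcongr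
    _ = _ := by ring

theorem integral_inner_grad_zhat_sub_z_le (hk : k < m) (hη : 0 ≤ η) :
    ∫ w, inner ℝ (A.grad f T ϑ φ r s k w) (A.zhat r s k w - A.z r s k w) ∂P ≤
      η * (√(sparsity T) / 2 * ∑ j ∈ Finset.range k with k ≤ j + τ,
        (meanSq P (A.grad f T ϑ φ r s k) + meanSq P (A.grad f T ϑ φ r s j))) := by
  have hG := hA.boundedMeasurable_grad h hr hs hk
  have hint : ∀ j ∈ {j ∈ Finset.range k | k ≤ j + τ}, Integrable (fun w =>
      ‖A.grad f T ϑ φ r s k w‖ * ‖mask (T (A.sample r s k w)) (A.grad f T ϑ φ r s j w)‖) P :=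
    fun j hj => (hG.comp₂ (hA.boundedMeasurable_mask_grad h hr hs hk
      (Finset.mem_range.1 (Finset.mem_filter.1 hj).1)) (q := fun x y => ‖x‖ * ‖y‖)
      (by fun_prop)).integrable
  refine (integral_mono (hG.inner ((hA.boundedMeasurable_zhat h hr hs hk).sub
    (hA.boundedMeasurable_z h hr hs hk.le))).integrable
    ((integrable_finsetSum _ hint).const_mul η)
    fun w => hA.inner_grad_zhat_sub_z_le h hr hs hk hη w).trans ?_
  rw [integral_const_mul, integral_finsetSum _ hint, Finset.mul_sum (a := √(sparsity T) / 2)]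
  gcongr with j hj
  exact hA.integral_norm_grad_mul_norm_mask_le h hr hs hk
    (Finset.mem_range.1 (Finset.mem_filter.1 hj).1)

theorem integral_inner_grad_z (hk : k < m) (hη : η ≠ 0) (x : Vec d) :
    ∫ w, inner ℝ (A.grad f T ϑ φ r s k w) (A.z r s k w - x) ∂P =
      1 / (2 * η) *
        (meanSq P (fun w => A.z r s k w - x) - meanSq P (fun w => A.z r s (k + 1) w - x)) +
      η / 2 * meanSq P (A.grad f T ϑ φ r s k) := by
  have hz {l : ℕ} (hl : l ≤ m) : Integrable (fun w => ‖A.z r s l w - x‖ ^ 2) P :=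
    ((hA.boundedMeasurable_z h hr hs hl).sub (.const x)).sq_norm.integrable
  have hG : Integrable (fun w => ‖A.grad f T ϑ φ r s k w‖ ^ 2) P :=
    (hA.boundedMeasurable_grad h hr hs hk).sq_norm.integrable
  have hdiff : Integrable
      (fun w => ‖A.z r s k w - x‖ ^ 2 - ‖A.z r s (k + 1) w - x‖ ^ 2) P := (hz hk.le).sub (hz hk)
  simp only [inner_sub_eq_of_step hη, ← hA.z_step r hr s hs k hk]
  rw [integral_add (hdiff.const_mul _) (hG.const_mul _), integral_const_mul,
    integral_const_mul, integral_sub (hz hk.le) (hz hk), meanSq, meanSq, meanSq]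

theorem integral_inner_grad_zhat_le (hk : k < m) (hη : 0 < η) (x : Vec d) :
    ∫ w, inner ℝ (A.grad f T ϑ φ r s k w) (A.zhat r s k w - x) ∂P ≤
      1 / (2 * η) *
        (meanSq P (fun w => A.z r s k w - x) - meanSq P (fun w => A.z r s (k + 1) w - x)) +
      η / 2 * meanSq P (A.grad f T ϑ φ r s k) +
      η * (√(sparsity T) / 2 * ∑ j ∈ Finset.range k with k ≤ j + τ,
        (meanSq P (A.grad f T ϑ φ r s k) + meanSq P (A.grad f T ϑ φ r s j))) := by
  have hG := hA.boundedMeasurable_grad h hr hs hk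
  have hz := hA.boundedMeasurable_z h hr hs hk.le
  have hsplit (w : Ω) : inner ℝ (A.grad f T ϑ φ r s k w) (A.zhat r s k w - x) =
      inner ℝ (A.grad f T ϑ φ r s k w) (A.z r s k w - x) +
      inner ℝ (A.grad f T ϑ φ r s k w) (A.zhat r s k w - A.z r s k w) := by
    rw [← inner_add_right, sub_add_sub_cancel']
  simp only [hsplit]
  rw [integral_add (hG.inner (hz.sub (.const x))).integrable
    (hG.inner ((hA.boundedMeasurable_zhat h hr hs hk).sub hz)).integrable,
    hA.integral_inner_grad_z h hr hs hk hη.ne']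
  gcongr
  exact hA.integral_inner_grad_zhat_sub_z_le h hr hs hk hη.le

theorem sum_integral_inner_grad_zhat_le (hη : 0 < η) (x : Vec d) :
    ∑ k ∈ Finset.range m, ∫ w, inner ℝ (A.grad f T ϑ φ r s k w) (A.zhat r s k w - x) ∂P ≤
      1 / (2 * η) *
        (meanSq P (fun w => A.z r s 0 w - x) - meanSq P (fun w => A.z r s m w - x)) +
      η / 2 * (1 + 2 * √(sparsity T) * τ) *
        ∑ k ∈ Finset.range m, meanSq P (A.grad f T ϑ φ r s k) := by
  set e := fun k => meanSq P (A.grad f T ϑ φ r s k)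
  set q := fun k => meanSq P (fun w => A.z r s k w - x)
  have hoverlap := sum_overlap_le m τ (e := e) fun k => meanSq_nonneg _
  calc _ ≤ ∑ k ∈ Finset.range m, (1 / (2 * η) * (q k - q (k + 1)) + η / 2 * e k +
        η * (√(sparsity T) / 2 * ∑ j ∈ Finset.range k with k ≤ j + τ, (e k + e j))) :=
        Finset.sum_le_sum fun k hk =>
          hA.integral_inner_grad_zhat_le h hr hs (Finset.mem_range.1 hk) hη x
    _ = 1 / (2 * η) * (q 0 - q m) + η / 2 * ∑ k ∈ Finset.range m, e k +
        η * (√(sparsity T) / 2 *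
          ∑ k ∈ Finset.range m, ∑ j ∈ Finset.range k with k ≤ j + τ, (e k + e j)) := by
        rw [Finset.sum_add_distrib, Finset.sum_add_distrib, ← Finset.mul_sum, ← Finset.mul_sum,
          ← Finset.mul_sum, ← Finset.mul_sum, Finset.sum_range_sub']
    _ ≤ 1 / (2 * η) * (q 0 - q m) + η / 2 * ∑ k ∈ Finset.range m, e k +
        η * (√(sparsity T) / 2 * (2 * τ * ∑ k ∈ Finset.range m, e k)) := by gcongr
    _ = _ := by ring

theorem expectedGap_snap_succ :
    expectedGap P f xstar (A.snap r (s + 1)) =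
      1 / (m : ℝ) * ∑ k ∈ Finset.range m, expectedGap P f xstar (A.yhat f T ϑ φ r s k) := by
  have hy (k : Fin m) : BoundedMeasurable mΩ (A.yhat f T ϑ φ r s k) :=
    hA.boundedMeasurable_yhat h hr hs k.2
  have hmeas (k : Fin m) : Measurable[MeasurableSpace.comap
      (fun w => fun k : Fin m => A.yhat f T ϑ φ r s k w) inferInstance]
      (fun w => obj f (A.yhat f T ϑ φ r s k w) - obj f xstar) :=
    (h.differentiable_obj.continuous.measurable.sub_const _).comp
      ((measurable_pi_apply k).comp (comap_measurable fun w (k : Fin m) => A.yhat f T ϑ φ r s k w))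
  rw [h.expectedGap_eq_integral (hA.boundedMeasurable_snap h hr hs), Finset.sum_range]
  simp only [hA.snap_succ r hr s hs, h.expectedGap_eq_integral (hy _)]
  rw [integral_select (hA.measurable_index r hr s hs) (hA.index_indep r hr s hs) hmeas
    fun k => (h.integrable_obj (hy k)).sub (integrable_const _), Finset.mul_sum]
  simp only [hA.index_uniform r hr s hs]

end

section

variable (h : IsProblem f T L μ xstar) (hA : IsRun P A f T ϑ (phi L ϑ) η S R τ x0)
  (h0 : 0 ≤ ϑ) (h1 : ϑ ≤ 1) (hr : r < R)
include h hA h0 h1 hr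

theorem expectedGap_yhat_le (hs : s < S) (hk : k < m) :
    expectedGap P f xstar (A.yhat f T ϑ (phi L ϑ) r s k) ≤
      (1 - ϑ) * expectedGap P f xstar (A.snap r s) -
      (1 - ϑ) / (2 * L) * meanSq P (A.grad f T ϑ (phi L ϑ) r s k) +
      ϑ * ∫ w, inner ℝ (A.grad f T ϑ (phi L ϑ) r s k w) (A.zhat r s k w - xstar) ∂P := by
  have hx := hA.boundedMeasurable_snap h hr hs.le
  have hzhat := hA.boundedMeasurable_zhat h hr hs hk
  have hy := hA.boundedMeasurable_yhat h hr hs hk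
  have hgap {X : Ω → Vec d} (hX : BoundedMeasurable mΩ X) :
      Integrable (fun w => obj f (X w) - obj f xstar) P :=
    (h.integrable_obj hX).sub (integrable_const _)
  have hvar : Integrable (fun w => 1 / (n : ℝ) * ∑ i, ‖gradEst f T i
      (A.yhat f T ϑ (phi L ϑ) r s k w) (A.snap r s w)‖ ^ 2) P :=
    (BoundedMeasurable.sum _ fun i _ =>
      (A.boundedMeasurable_gradEst h hzhat hx i).sq_norm).integrable.const_mul _
  have hinner := ((hy.comp h.continuous_gradient_obj).inner
    (hzhat.sub (.const xstar))).integrable (P := P)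
  have hdiff : Integrable (fun w => (1 - ϑ) * (obj f (A.snap r s w) - obj f xstar) -
      (1 - ϑ) / (2 * L) * (1 / (n : ℝ) * ∑ i, ‖gradEst f T i
        (A.yhat f T ϑ (phi L ϑ) r s k w) (A.snap r s w)‖ ^ 2)) P :=
    ((hgap hx).const_mul _).sub (hvar.const_mul _)
  rw [meanSq, hA.integral_sq_norm_grad h hr hs hk, hA.integral_inner_grad h hr hs hk
    ((hA.boundedMeasurable_zhat_past h hr hs hk le_rfl).sub (.const xstar)),
    h.expectedGap_eq_integral hy, h.expectedGap_eq_integral hx, ← integral_const_mul,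
    ← integral_const_mul, ← integral_const_mul,
    ← integral_sub ((hgap hx).const_mul _) (hvar.const_mul _), ← integral_add hdiff
    (hinner.const_mul _)]
  exact integral_mono (hgap hy) (hdiff.add (hinner.const_mul _))
    fun w => h.obj_couple_sub_le h0 h1 (A.zhat r s k w) (A.snap r s w) xstar rfl

variable (hη : 0 < η) (hηϑ : L * ϑ * η * (1 + 2 * √(sparsity T) * τ) ≤ 1 - ϑ) (hm : 0 < m)
include hη hηϑ hm

theorem expectedGap_snap_succ_le (hs : s < S) :
    expectedGap P f xstar (A.snap r (s + 1)) ≤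
      (1 - ϑ) * expectedGap P f xstar (A.snap r s) +
      ϑ / (2 * η * m) * (meanSq P (fun w => A.z r s 0 w - xstar) -
        meanSq P (fun w => A.z r (s + 1) 0 w - xstar)) := by
  have : (0 : ℝ) < m := Nat.cast_pos.2 hm
  have hL := h.L_pos
  set q := fun k => meanSq P (fun w => A.z r s k w - xstar)
  set E := ∑ k ∈ Finset.range m, meanSq P (A.grad f T ϑ (phi L ϑ) r s k)
  have hE : 0 ≤ E := Finset.sum_nonneg fun _ _ => meanSq_nonneg _
  have hinner := hA.sum_integral_inner_grad_zhat_le h hr hs hη xstar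
  have hvariance : ϑ * (η / 2 * (1 + 2 * √(sparsity T) * τ)) ≤ (1 - ϑ) / (2 * L) := by
    rw [le_div_iff₀ (by positivity)]
    linarith
  have hsum : ∑ k ∈ Finset.range m, expectedGap P f xstar (A.yhat f T ϑ (phi L ϑ) r s k) ≤
      m * ((1 - ϑ) * expectedGap P f xstar (A.snap r s)) + ϑ * (1 / (2 * η) * (q 0 - q m)) := by
    calc _ ≤ m * ((1 - ϑ) * expectedGap P f xstar (A.snap r s)) - (1 - ϑ) / (2 * L) * E +
          ϑ * ∑ k ∈ Finset.range m, ∫ w, inner ℝ (A.grad f T ϑ (phi L ϑ) r s k w)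
            (A.zhat r s k w - xstar) ∂P := by
          refine (Finset.sum_le_sum fun k hk =>
            hA.expectedGap_yhat_le h h0 h1 hr hs (Finset.mem_range.1 hk)).trans_eq ?_
          rw [Finset.sum_add_distrib, Finset.sum_sub_distrib, Finset.sum_const,
            Finset.card_range, nsmul_eq_mul, ← Finset.mul_sum, ← Finset.mul_sum]
      _ ≤ _ := by nlinarith
  rw [hA.expectedGap_snap_succ h hr hs]
  simp only [hA.z_epoch r hr s hs]
  calc _ ≤ 1 / (m : ℝ) * (m * ((1 - ϑ) * expectedGap P f xstar (A.snap r s)) +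
        ϑ * (1 / (2 * η) * (q 0 - q m))) := by gcongr
    _ = _ := by simp only [q]; field_simp

theorem expectedGap_x_succ_le (hS : 0 < S) :
    S * ϑ * expectedGap P f xstar (A.x (r + 1)) ≤
      ((1 - ϑ) + ϑ / (η * m * μ)) * expectedGap P f xstar (A.x r) := by
  have : (0 : ℝ) < m := Nat.cast_pos.2 hm
  have : (0 : ℝ) < S := Nat.cast_pos.2 hS
  have hμ := h.mu_pos
  have hx := hA.boundedMeasurable_x h hr.le
  have htelescope := mul_sum_succ_le_of_le_add_sub (S := S)
    (a := fun s => expectedGap P f xstar (A.snap r s))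
    (b := fun s => meanSq P fun w => A.z r s 0 w - xstar) (c := ϑ / (2 * η * m)) h1
    (by positivity) (fun s hs => hA.expectedGap_snap_succ_le h h0 h1 hr hη hηϑ hm hs)
    (h.expectedGap_nonneg (hA.boundedMeasurable_snap h hr le_rfl)) (meanSq_nonneg _)
  simp only [funext (hA.snap_zero r hr), hA.z_zero r hr] at htelescope
  have hjensen := h.expectedGap_avg_le (P := P) hS fun s hs =>
    hA.boundedMeasurable_snap h hr (Finset.mem_range.1 hs)
  rw [← funext (hA.restart r hr)] at hjensen
  calc _ ≤ S * ϑ * (1 / (S : ℝ) * ∑ s ∈ Finset.range S,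
        expectedGap P f xstar (A.snap r (s + 1))) := by gcongr
    _ = ϑ * ∑ s ∈ Finset.range S, expectedGap P f xstar (A.snap r (s + 1)) := by field_simp
    _ ≤ (1 - ϑ) * expectedGap P f xstar (A.x r) +
        ϑ / (η * m * μ) * (μ / 2 * meanSq P fun w => A.x r w - xstar) :=
        htelescope.trans_eq (by field_simp)
    _ ≤ (1 - ϑ) * expectedGap P f xstar (A.x r) +
        ϑ / (η * m * μ) * expectedGap P f xstar (A.x r) := by
        gcongr
        exact h.meanSq_sub_le_expectedGap hx
    _ = _ := by ring

end

end IsRun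

end Descent

/-! ### The choice of parameters -/

section Parameters

variable {κ ρ : ℝ} {m : ℕ}

theorem theta_pos (hm : 0 < m) : 0 < theta κ ρ m := by
  have : (0 : ℝ) < m := Nat.cast_pos.2 hm
  unfold theta
  positivity

theorem theta_lt_one (hκ : 0 < κ) (hρ : 0 < ρ) : theta κ ρ m < 1 := by
  rw [theta, div_lt_one (by positivity)]
  exact lt_add_of_pos_left _ (by positivity)

theorem one_sub_theta (hm : 0 < m) : 1 - theta κ ρ m = theta κ ρ m * √(κ / m * ρ) := by
  have hm' : (0 : ℝ) < m := Nat.cast_pos.2 hm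
  rw [theta, div_mul_eq_mul_div κ, Real.sqrt_div' _ hm'.le]
  field_simp
  ring

theorem eta_pos {L ϑ : ℝ} (hL : 0 < L) (h0 : 0 < ϑ) (h1 : ϑ < 1) (hρ : 0 < ρ) : 0 < eta L ϑ ρ :=
  div_pos (sub_pos.2 h1) (by positivity)

theorem mul_eta_mul {L ϑ : ℝ} (hL : L ≠ 0) (hϑ : ϑ ≠ 0) (hρ : ρ ≠ 0) :
    L * ϑ * eta L ϑ ρ * ρ = 1 - ϑ := by
  rw [eta]
  field_simp

theorem one_sub_theta_add_theta_div {L μ : ℝ} (hL : 0 < L) (hμ : 0 < μ) (hρ : 0 < ρ) (hm : 0 < m) :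
    (1 - theta (L / μ) ρ m) +
      theta (L / μ) ρ m / (eta L (theta (L / μ) ρ m) ρ * m * μ) =
      2 * theta (L / μ) ρ m * √(L / μ / m * ρ) := by
  have : (0 : ℝ) < m := Nat.cast_pos.2 hm
  have hϑ := theta_pos (κ := L / μ) (ρ := ρ) hm
  have : 0 < √(L / μ / m * ρ) := by positivity
  have hsq := Real.sq_sqrt (show 0 ≤ L / μ / m * ρ by positivity)
  have heta : eta L (theta (L / μ) ρ m) ρ = √(L / μ / m * ρ) / (L * ρ) := by
    rw [eta, one_sub_theta hm]
    field_simp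
  rw [heta, one_sub_theta hm]
  field_simp at hsq ⊢
  linear_combination -hsq

theorem sqrt_mul_le_of_le {Δ c τ M : ℝ} (hc : 0 ≤ c) (hM : 0 ≤ M) (hτ : τ ≤ c * (1 / √Δ * M)) :
    √Δ * τ ≤ c * M := by
  calc √Δ * τ ≤ √Δ * (c * (1 / √Δ * M)) := by gcongr
    _ = (√Δ * (√Δ)⁻¹) * (c * M) := by ring
    _ ≤ 1 * (c * M) := by gcongr; exact mul_inv_le_one
    _ = _ := one_mul _

theorem div_mul_le_mul_max {c₁ c N : ℝ} (hc₁ : 0 < c₁) (hc : 0 ≤ c) (hN : 0 < N) (hκ : 0 < κ)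
    (hm : c₁ * N ≤ m) (hρ : ρ ≤ 1 + 2 * (c * max (N / κ) 1)) :
    κ / m * ρ ≤ (1 + 2 * c) / c₁ * max 1 (κ / N) := by
  have hmax : κ / N * max (N / κ) 1 = max 1 (κ / N) := by
    rw [mul_max_of_nonneg _ _ (by positivity), mul_one, div_mul_div_cancel₀ hN.ne',
      div_self hκ.ne']
  have : 0 ≤ max (N / κ) 1 := zero_le_one.trans (le_max_right _ _)
  calc κ / m * ρ ≤ κ / m * (1 + 2 * (c * max (N / κ) 1)) := by gcongr
    _ ≤ κ / (c₁ * N) * (1 + 2 * (c * max (N / κ) 1)) := by gcongr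
    _ = 1 / c₁ * (κ / N + 2 * c * (κ / N * max (N / κ) 1)) := by field_simp
    _ ≤ 1 / c₁ * (max 1 (κ / N) + 2 * c * max 1 (κ / N)) := by
      rw [hmax]
      gcongr
      exact le_max_right _ _
    _ = _ := by ring

theorem exists_epochs_le {ω c₁ c : ℝ} (hω : 0 ≤ ω) (hc₁ : 0 < c₁) (hc : 0 ≤ c) :
    ∃ C : ℝ, 1 ≤ C ∧ ∀ {N κ ρ : ℝ} {m : ℕ}, 0 < N → 0 < κ → c₁ * N ≤ m →
      ρ ≤ 1 + 2 * (c * max (N / κ) 1) → (epochs ω κ ρ m : ℝ) ≤ C * max 1 √(κ / N) := by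
  refine ⟨2 * ω * √((1 + 2 * c) / c₁) + 1, le_add_of_nonneg_left (by positivity), ?_⟩
  intro N κ ρ m hN hκ hm hρ
  have hsqrt_max : √(max 1 (κ / N)) = max 1 √(κ / N) := by
    rw [Real.sqrt_monotone.map_max, Real.sqrt_one]
  have hsqrt_le := Real.sqrt_le_sqrt (div_mul_le_mul_max hc₁ hc hN hκ hm hρ)
  calc (epochs ω κ ρ m : ℝ) ≤ 2 * ω * √(κ / m * ρ) + 1 :=
        (Nat.ceil_lt_add_one (by positivity)).le
    _ ≤ 2 * ω * √((1 + 2 * c) / c₁ * max 1 (κ / N)) + 1 := by gcongr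
    _ = 2 * ω * (√((1 + 2 * c) / c₁) * max 1 √(κ / N)) + 1 := by
      rw [Real.sqrt_mul (by positivity), hsqrt_max]
    _ ≤ 2 * ω * (√((1 + 2 * c) / c₁) * max 1 √(κ / N)) + max 1 √(κ / N) := by
      gcongr
      exact le_max_left _ _
    _ = _ := by ring

theorem inv_pow_mul_le {ω D ε : ℝ} {R : ℕ} (hω : 1 < ω) (hD : 0 ≤ D) (hε : 0 < ε)
    (hR : Real.log (D / ε) / Real.log ω ≤ R) : ω⁻¹ ^ R * D ≤ ε := by
  rcases hD.eq_or_lt with rfl | hD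
  · simpa using hε.le
  have hω0 : 0 < ω := one_pos.trans hω
  rw [div_le_iff₀ (Real.log_pos hω), ← Real.log_pow,
    Real.log_le_log_iff (by positivity) (by positivity), div_le_iff₀ hε] at hR
  rwa [inv_pow, inv_mul_le_iff₀ (by positivity)]

theorem exists_rounds_le {ω : ℝ} (hω : 1 < ω) :
    ∃ C : ℝ, 1 ≤ C ∧ ∀ {D ε : ℝ}, 0 ≤ D → 0 < ε →
      ∃ R : ℕ, (R : ℝ) ≤ C * max 1 (Real.log (D / ε)) ∧ ω⁻¹ ^ R * D ≤ ε := by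
  have hlog := Real.log_pos hω
  refine ⟨1 / Real.log ω + 1, le_add_of_nonneg_left (by positivity), fun {D ε} hD hε => ?_⟩
  set ℓ := max 1 (Real.log (D / ε))
  have hℓ : 1 ≤ ℓ := le_max_left _ _
  refine ⟨⌈ℓ / Real.log ω⌉₊, ?_, inv_pow_mul_le hω hD hε ?_⟩
  · calc (⌈ℓ / Real.log ω⌉₊ : ℝ) ≤ ℓ / Real.log ω + 1 := (Nat.ceil_lt_add_one (by positivity)).le
      _ ≤ ℓ / Real.log ω + ℓ := by gcongr
      _ = _ := by ring
  · exact (div_le_div_of_nonneg_right (le_max_right _ _) hlog.le).trans (Nat.le_ceil _)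

theorem mul_max_one_sqrt_div {N : ℝ} (hN : 0 < N) : N * max 1 √(κ / N) = max N √(κ * N) := by
  have hsqrt : N * √(κ / N) = √(κ * N) := by
    rw [← Real.sqrt_sq hN.le, ← Real.sqrt_mul (sq_nonneg N), Real.sqrt_sq hN.le]
    congr 1
    field_simp
  rw [mul_max_of_nonneg _ _ hN.le, mul_one, hsqrt]

theorem oracleCalls_eq (n m S R : ℕ) : oracleCalls n m S R = R * S * (n + 2 * m) := by
  simp only [oracleCalls, Finset.sum_const, Finset.card_range, smul_eq_mul]
  ring

theorem oracleCalls_le {n S R : ℕ} {CR CS c₂ ℓ : ℝ} (hn : 0 < n) (hm : (m : ℝ) ≤ c₂ * n)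
    (hR : (R : ℝ) ≤ CR * ℓ) (hS : (S : ℝ) ≤ CS * max 1 √(κ / (n : ℝ))) :
    (oracleCalls n m S R : ℝ) ≤ CR * CS * (1 + 2 * c₂) * (max (n : ℝ) √(κ * (n : ℝ)) * ℓ) := by
  rw [oracleCalls_eq, ← mul_max_one_sqrt_div (Nat.cast_pos.2 hn)]
  have hR0 : 0 ≤ CR * ℓ := R.cast_nonneg.trans hR
  have hS0 : 0 ≤ CS * max 1 √(κ / (n : ℝ)) := S.cast_nonneg.trans hS
  push_cast
  calc (R : ℝ) * S * (n + 2 * m)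
      ≤ CR * ℓ * (CS * max 1 √(κ / (n : ℝ))) * (n + 2 * (c₂ * n)) := by gcongr
    _ = _ := by ring

end Parameters

/-! ### Linear convergence -/

section Convergence

variable {Ω : Type*} [MeasurableSpace Ω] {P : Measure Ω} [IsProbabilityMeasure P] {n d m : ℕ}
  {f : Fin n → Vec d → ℝ} {T : Fin n → Finset (Fin d)} {L μ ρ ω ϑ : ℝ} {xstar x0 : Vec d}
  {A : Execution Ω n d m} {R τ r : ℕ}

theorem IsProblem.obj_sub_nonneg (h : IsProblem f T L μ xstar) (x : Vec d) :
    0 ≤ obj f x - obj f xstar :=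
  (mul_nonneg (half_pos h.mu_pos).le (sq_nonneg _)).trans (h.growth x)

theorem IsRun.expectedGap_x_succ_le_inv_mul (h : IsProblem f T L μ xstar)
    (hA : IsRun P A f T ϑ (phi L ϑ) (eta L ϑ ρ) (epochs ω (L / μ) ρ m) R τ x0) (hω : 0 < ω)
    (hm : 0 < m) (hρ : 1 + 2 * √(sparsity T) * τ ≤ ρ) (hϑ : ϑ = theta (L / μ) ρ m) (hr : r < R) :
    expectedGap P f xstar (A.x (r + 1)) ≤ ω⁻¹ * expectedGap P f xstar (A.x r) := by
  have : (0 : ℝ) < m := Nat.cast_pos.2 hm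
  have hρ0 : 0 < ρ := lt_of_lt_of_le (by positivity) hρ
  have hL := h.L_pos
  have hκ : 0 < L / μ := div_pos hL h.mu_pos
  have h0 : 0 < ϑ := hϑ ▸ theta_pos hm
  have h1 : ϑ < 1 := hϑ ▸ theta_lt_one hκ hρ0
  have hη := eta_pos hL h0 h1 hρ0
  have hηϑ : L * ϑ * eta L ϑ ρ * (1 + 2 * √(sparsity T) * τ) ≤ 1 - ϑ := by
    rw [← mul_eta_mul hL.ne' h0.ne' hρ0.ne']
    gcongr
  have hS : 0 < epochs ω (L / μ) ρ m := Nat.ceil_pos.2 (by positivity)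
  have hS' : (0 : ℝ) < epochs ω (L / μ) ρ m := Nat.cast_pos.2 hS
  have hceil : 2 * ω * √(L / μ / m * ρ) ≤ epochs ω (L / μ) ρ m := Nat.le_ceil _
  have hgap := h.expectedGap_nonneg (P := P) (hA.boundedMeasurable_x h hr.le)
  have hround := hA.expectedGap_x_succ_le h h0.le h1.le hr hη hηϑ hm hS
  have hfactor : (1 - ϑ) + ϑ / (eta L ϑ ρ * m * μ) ≤ epochs ω (L / μ) ρ m * ϑ * ω⁻¹ := by
    rw [hϑ, one_sub_theta_add_theta_div hL h.mu_pos hρ0 hm, ← hϑ, le_mul_inv_iff₀ hω]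
    linarith [mul_le_mul_of_nonneg_right hceil h0.le]
  refine le_of_mul_le_mul_left (hround.trans ?_) (mul_pos hS' h0)
  rw [← mul_assoc]
  gcongr

theorem IsRun.expectedGap_x_le (h : IsProblem f T L μ xstar)
    (hA : IsRun P A f T ϑ (phi L ϑ) (eta L ϑ ρ) (epochs ω (L / μ) ρ m) R τ x0) (hω : 0 < ω)
    (hm : 0 < m) (hρ : 1 + 2 * √(sparsity T) * τ ≤ ρ) (hϑ : ϑ = theta (L / μ) ρ m) (hr : r ≤ R) :
    expectedGap P f xstar (A.x r) ≤ ω⁻¹ ^ r * (obj f x0 - obj f xstar) := by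
  induction r with
  | zero => simp [expectedGap, hA.init]
  | succ r ih =>
    calc _ ≤ ω⁻¹ * expectedGap P f xstar (A.x r) :=
          hA.expectedGap_x_succ_le_inv_mul h hω hm hρ hϑ hr
      _ ≤ ω⁻¹ * (ω⁻¹ ^ r * (obj f x0 - obj f xstar)) := by
          gcongr
          exact ih (Nat.le_of_succ_le hr)
      _ = _ := by rw [pow_succ', mul_assoc]

end Convergence

end AsyncSVRG

theorem corollary1 :
    -- the constants of `ω`, of `m = Θ(n)` and of the bound on the overlaps; `C` depends on them only
    ∀ ω c₁ c₂ c : ℝ, 1 < ω → 0 < c₁ → 0 < c₂ → 0 < c →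
    ∃ C : ℝ, 0 < C ∧
    ∀ (n d : ℕ) (f : Fin n → AsyncSVRG.Vec d → ℝ) (T : Fin n → Finset (Fin d)) (L μ : ℝ)
      (xstar : AsyncSVRG.Vec d), AsyncSVRG.IsProblem f T L μ xstar →
    ∀ (m : ℕ), c₁ * (n : ℝ) ≤ (m : ℝ) → (m : ℝ) ≤ c₂ * (n : ℝ) →
    ∀ (κ Δ B : ℝ), κ = L / μ → Δ = AsyncSVRG.sparsity T → B = 1 / √Δ * max ((n : ℝ) / κ) 1 →
    ∀ (τ : ℕ), (τ : ℝ) ≤ c * B →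
    ∀ (τt : ℝ), (τ : ℝ) ≤ τt → τt ≤ c * B →
    ∀ (ρ ϑ φ η : ℝ) (S : ℕ), ρ = 1 + 2 * √Δ * τt →
      ϑ = AsyncSVRG.theta κ ρ m → φ = AsyncSVRG.phi L ϑ → η = AsyncSVRG.eta L ϑ ρ →
      S = AsyncSVRG.epochs ω κ ρ m →
    (S : ℝ) ≤ C * max 1 √(κ / (n : ℝ)) ∧
    ∀ (x0 : AsyncSVRG.Vec d) (ε logTerm : ℝ), 0 < ε →
      logTerm = max 1 (Real.log ((AsyncSVRG.obj f x0 - AsyncSVRG.obj f xstar) / ε)) →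
    ∃ R : ℕ, (R : ℝ) ≤ C * logTerm ∧
      AsyncSVRG.oracleCalls n m S R = R * S * (n + 2 * m) ∧
      (AsyncSVRG.oracleCalls n m S R : ℝ) ≤ C * (max (n : ℝ) √(κ * (n : ℝ)) * logTerm) ∧
      ∀ (Ω : Type*) [MeasurableSpace Ω] (P : MeasureTheory.Measure Ω)
        [MeasureTheory.IsProbabilityMeasure P] (A : AsyncSVRG.Execution Ω n d m),
        AsyncSVRG.IsRun P A f T ϑ φ η S R τ x0 →
        MeasureTheory.Integrable (fun w => AsyncSVRG.obj f (A.x R w)) P ∧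
        ∫ w, AsyncSVRG.obj f (A.x R w) ∂P - AsyncSVRG.obj f xstar ≤ ε := by
  intro ω c₁ c₂ c hω hc₁ hc₂ hc
  have hω0 := one_pos.trans hω
  obtain ⟨CS, hCS, hepochs⟩ := AsyncSVRG.exists_epochs_le hω0.le hc₁ hc.le
  obtain ⟨CR, hCR, hrounds⟩ := AsyncSVRG.exists_rounds_le hω
  refine ⟨CR * CS * (1 + 2 * c₂), by positivity, ?_⟩
  rintro n d f T L μ xstar h m hm₁ hm₂ _ _ _ rfl rfl rfl τ - τt hτ hτt
  rintro _ _ _ _ _ rfl rfl rfl rfl rfl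
  have hn : (0 : ℝ) < n := Nat.cast_pos.2 h.n_pos
  have hκ : 0 < L / μ := div_pos h.L_pos h.mu_pos
  have hm : 0 < m := Nat.cast_pos.1 ((mul_pos hc₁ hn).trans_le hm₁)
  have hdelay := AsyncSVRG.sqrt_mul_le_of_le hc.le (by positivity) hτt
  have hS := hepochs hn hκ hm₁ (ρ := 1 + 2 * √(AsyncSVRG.sparsity T) * τt) (by linarith)
  have hCRS : CR * CS ≤ CR * CS * (1 + 2 * c₂) :=
    le_mul_of_one_le_right (by positivity) (by linarith)
  refine ⟨hS.trans (by gcongr; exact (le_mul_of_one_le_left (by positivity) hCR).trans hCRS), ?_⟩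
  rintro x0 ε _ hε rfl
  obtain ⟨R, hR, hgap⟩ := hrounds (h.obj_sub_nonneg x0) hε
  refine ⟨R, hR.trans (by gcongr; exact (le_mul_of_one_le_right (by positivity) hCS).trans hCRS),
    AsyncSVRG.oracleCalls_eq n m _ R, AsyncSVRG.oracleCalls_le h.n_pos hm₂ hR hS, ?_⟩
  intro Ω _ P _ A hA
  exact ⟨h.integrable_obj (hA.boundedMeasurable_x h le_rfl),
    (hA.expectedGap_x_le h hω0 hm (by gcongr) rfl le_rfl).trans hgap⟩
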